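/- Let $D\subset\mathbb{C}^n$ ($n\ge 1$) be a bounded convex domain with a smooth defining function $\rho:\mathbb{C}^n\to\mathbb{R}$, i.e. $\rho\in C^\infty$, $D=\{\rho<0\}$ and $d\rho\ne 0$ on $\partial D$. Suppose $D$ has finite type: at every $q\in\partial D$ the D'Angelo $1$-type $\sup_\gamma \nu(\rho\circ\gamma)/\nu(\gamma-q)$ is finite, where $\gamma$ runs over the nonconstant germs of holomorphic curves with $\gamma(0)=q$ and $\nu$ denotes the order of vanishing at $0$. For a domain $\Omega\subset\mathbb{C}^n$ and $p\in\Omega$ let $$k_\Omega(p)=\inf\{|\det\psi'(0)|^{-2}:\ \psi:\mathbb{B}^n\to\Omega \text{ holomorphic},\ \psi(0)=p\}$$ be the Kobayashi–Eisenman volume element ($\mathbb{B}^n$ is the unit ball). For $p\in D$ and $\epsilon>0$ put $D_{p,\epsilon}=\{z:\rho(z)<\rho(p)+\epsilon\}$. McNeal's radii $\tau_n(p,\epsilon),\dots,\tau_1(p,\epsilon)$ and points $\zeta_n(p,\epsilon),\dots,\zeta_1(p,\epsilon)\in\partial D_{p,\epsilon}$ are constructed as follows: $\tau_n$ is the distance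 from $p$ to $\partial D_{p,\epsilon}$, and $\zeta_n$ is a boundary point realising it. Once $\zeta_n,\dots,\zeta_{\alpha+1}$ have been chosen, $\tau_\alpha$ is the largest of the distances from $p$ to $\partial D_{p,\epsilon}$ along complex lines through $p$ orthogonal to $\zeta_n-p,\dots,\zeta_{\alpha+1}-p$, and $\zeta_\alpha\in\partial D_{p,\epsilon}$ is a nearest boundary point on such a line with $|\zeta_\alpha-p|=\tau_\alpha$. Let $U^{p,\epsilon}$ be the unitary map with $U^{p,\epsilon}(\zeta_\alpha-p)=\tau_\alpha e_\alpha$ for all $\alpha$, where $e_1,\dots,e_n$ is the standard basis, and let $$S^{p,\epsilon}(z)=\Big(\frac{(U^{p,\epsilon}(z-p))_1}{\tau_1(p,\epsilon)},\dots,\frac{(U^{p,\epsilon}(z-p))_n}{\tau_n(p,\epsilon)}\Big).$$ Let $p^j\in D$ converge to $p^0\in\partial D$, and let $\epsilon_j=-\rho(p^j)$. Then, for any choices made in the construction at the points $p^j$ with $\epsilon=\epsilon_j$, after passing to a subsequence the following hold. (i) The functions $\frac1{\epsilon_j}\,\rho\circ (S^{p^j,\epsilon_j})^{-1}$ converge,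 uniformly on compact subsets of $\mathbb{C}^n$, to a function $$\rho_\infty(z)=-1+\operatorname{Re}\sum_{\alpha=1}^n b_\alpha z_\alpha+P_{2m}({}'z),\qquad {}'z=(z_1,\dots,z_{n-1}),$$ where $b_\alpha\in\mathbb{C}$, $m\ge1$, and $P_{2m}$ is a real convex polynomial in the real and imaginary parts of $z_1,\dots,z_{n-1}$ of degree at most $2m$, and, if $n\ge2$, $2m$ is the D'Angelo $1$-type of $\partial D$ at $p^0$. (For $n=1$, $P_{2m}$ is a constant.) The domain $D_\infty=\{\rho_\infty<0\}$ is called a local model of $D$ at $p^0$. (ii) As $j\to\infty$, $$k_D(p^j)\prod_{\alpha=1}^n\tau_\alpha(p^j,\epsilon_j)^2\ \longrightarrow\ k_{D_\infty}(0).$$ -/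

import Mathlib

open Set Filter Topology
open scoped ContDiff ENNReal

noncomputable section

/-- The complex Euclidean space `ℂ^d` with its Hermitian inner product. -/
abbrev Cn (d : ℕ) : Type := EuclideanSpace ℂ (Fin d)

/-- The Kobayashi-Eisenman volume element
`k_D(p) = inf { |det ψ'(0)|⁻² : ψ : 𝔹 → D holomorphic, ψ(0) = p }`.
Maps with `det ψ'(0) = 0`, for which `|det ψ'(0)|⁻² = +∞`, are left out of the infimum. -/
def kobayashiVol {d : ℕ} (D : Set (Cn d)) (p : Cn d) : ℝ :=
  sInf {x : ℝ | ∃ ψ : Cn d → Cn d, DifferentiableOn ℂ ψ (Metric.ball 0 1) ∧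
    MapsTo ψ (Metric.ball 0 1) D ∧ ψ 0 = p ∧
    (fderiv ℂ ψ 0).det ≠ 0 ∧ x = (‖(fderiv ℂ ψ 0).det‖ ^ 2)⁻¹}

/-- `ρ` is a smooth defining function of `D`: `D = {ρ < 0}` and `dρ ≠ 0` on `∂D`. -/
structure IsSmoothDefiningFunction {d : ℕ} (ρ : Cn d → ℝ) (D : Set (Cn d)) : Prop where
  smooth : ContDiff ℝ ∞ ρ
  sublevel : D = {z | ρ z < 0}
  regular : ∀ z ∈ frontier D, fderiv ℝ ρ z ≠ 0

/-- The order of vanishing at `0` of a real function of one complex variable: the supremum of all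
`k` with `g(t) = O(|t|^k)` as `t → 0` (for smooth `g`, the order of the Taylor series). -/
def vanishingOrder (g : ℂ → ℝ) : ℕ∞ :=
  ⨆ (k : ℕ) (_ : g =O[𝓝 0] fun t : ℂ => ‖t‖ ^ k), (k : ℕ∞)

/-- D'Angelo's 1-type at `p` of the hypersurface defined by `ρ`: the supremum of
`ν(ρ ∘ γ) / ν(γ - p)` over all nonconstant germs of holomorphic curves `γ` with `γ(0) = p`,
where `ν` is the order of vanishing at `0`. -/
def dAngeloType {d : ℕ} (ρ : Cn d → ℝ) (p : Cn d) : ℝ≥0∞ :=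
  ⨆ (γ : ℂ → Cn d) (_ : AnalyticAt ℂ γ 0) (_ : γ 0 = p)
    (_ : analyticOrderAt (fun t => γ t - p) 0 ≠ ⊤),
    ((vanishingOrder (ρ ∘ γ) : ℕ∞) : ℝ≥0∞) /
      ((analyticOrderAt (fun t => γ t - p) 0 : ℕ∞) : ℝ≥0∞)

/-- The domain `D_{p,ε} = {z : ρ(z) < ρ(p) + ε}`. -/
def shiftedDomain {d : ℕ} (ρ : Cn d → ℝ) (p : Cn d) (ε : ℝ) : Set (Cn d) :=
  {z | ρ z < ρ p + ε}

/-- The distance from `p` to `∂Ω` along the complex line `p + ℂ v`. -/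
def lineDist {d : ℕ} (Ω : Set (Cn d)) (p v : Cn d) : ℝ :=
  Metric.infDist p (frontier Ω ∩ range fun c : ℂ => p + c • v)

/-- `τ`, `ζ`, `U` are the radii `τ_α(p,ε)`, the boundary points `ζ_α(p,ε)` and the unitary map
`U^{p,ε}` produced by some run of McNeal's construction at `p` (the points `ζ_α` need not be
unique). The dimension is `n + 1`; the coordinate `Fin.last n` is treated first, and one proceeds
downwards. -/
structure IsMcNealSystem {n : ℕ} (ρ : Cn (n + 1) → ℝ) (p : Cn (n + 1)) (ε : ℝ)
    (τ : Fin (n + 1) → ℝ) (ζ : Fin (n + 1) → Cn (n + 1))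
    (U : Cn (n + 1) ≃ₗᵢ[ℂ] Cn (n + 1)) : Prop where
  /-- The points `ζ_α` lie on the boundary of `D_{p,ε}`, at distance `τ_α` from `p`. -/
  mem_frontier : ∀ α, ζ α ∈ frontier (shiftedDomain ρ p ε)
  dist_eq : ∀ α, dist p (ζ α) = τ α
  /-- The last radius is the distance from `p` to the boundary of `D_{p,ε}`. -/
  last_eq : τ (Fin.last n) = Metric.infDist p (frontier (shiftedDomain ρ p ε))
  /-- Each `ζ_α` lies in the complex subspace through `p` that is orthogonal to the
  previously chosen vectors. -/
  orthogonal : ∀ α β, α < β → inner ℂ (ζ β - p) (ζ α - p) = 0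
  /-- The other radii are the largest distances from `p` to the boundary along complex lines
  through `p` in this subspace. -/
  isGreatest : ∀ α, α < Fin.last n →
    IsGreatest {r : ℝ | ∃ v : Cn (n + 1), v ≠ 0 ∧
      (∀ β, α < β → inner ℂ (ζ β - p) v = 0) ∧ r = lineDist (shiftedDomain ρ p ε) p v} (τ α)
  /-- The point `ζ_α` realises the distance along its own complex line. -/
  realises : ∀ α, α < Fin.last n → lineDist (shiftedDomain ρ p ε) p (ζ α - p) = τ α
  /-- `U` sends `ζ_α - p` to the positive real half-axis of the `α`-th coordinate. -/
  align : ∀ α, U (ζ α - p) = EuclideanSpace.single α (τ α : ℂ)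

/-- The scaling map `S = Λ ∘ U ∘ T`: translation of `p` to the origin, followed by `U`, followed by
the dilation `z_α ↦ z_α / τ_α`. -/
def scalingMap {d : ℕ} (p : Cn d) (τ : Fin d → ℝ) (U : Cn d ≃ₗᵢ[ℂ] Cn d) (z : Cn d) : Cn d :=
  WithLp.toLp 2 fun α => U (z - p) α / (τ α : ℂ)

/-- The inverse of the scaling map. -/
def scalingMapInv {d : ℕ} (p : Cn d) (τ : Fin d → ℝ) (U : Cn d ≃ₗᵢ[ℂ] Cn d) (w : Cn d) : Cn d :=
  p + U.symm (WithLp.toLp 2 fun α => (τ α : ℂ) * w α)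

theorem scalingMap_scalingMapInv {d : ℕ} (p : Cn d) (τ : Fin d → ℝ) (U : Cn d ≃ₗᵢ[ℂ] Cn d)
    (hτ : ∀ α, τ α ≠ 0) (w : Cn d) : scalingMap p τ U (scalingMapInv p τ U w) = w := by
  ext α
  have h : (τ α : ℂ) ≠ 0 := by exact_mod_cast hτ α
  simp [scalingMap, scalingMapInv, h]

theorem scalingMapInv_scalingMap {d : ℕ} (p : Cn d) (τ : Fin d → ℝ) (U : Cn d ≃ₗᵢ[ℂ] Cn d)
    (hτ : ∀ α, τ α ≠ 0) (z : Cn d) : scalingMapInv p τ U (scalingMap p τ U z) = z := by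
  have h : (WithLp.toLp 2 fun α => (τ α : ℂ) * (scalingMap p τ U z) α : Cn d) = U (z - p) := by
    ext α
    have h : (τ α : ℂ) ≠ 0 := by exact_mod_cast hτ α
    simp only [scalingMap]
    field_simp
  simp [scalingMapInv, h]

/-- The scaled function `(1/ε) ρ ∘ S⁻¹` with `ε = -ρ(p)`. -/
def scaledFunction {d : ℕ} (ρ : Cn d → ℝ) (p : Cn d) (τ : Fin d → ℝ) (U : Cn d ≃ₗᵢ[ℂ] Cn d)
    (w : Cn d) : ℝ :=
  ρ (scalingMapInv p τ U w) / (-ρ p)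

/-- The value at `w ∈ ℂ^n` of a real polynomial in the real and imaginary parts of the
coordinates. -/
def realPolyEval {n : ℕ} (P : MvPolynomial (Fin n ⊕ Fin n) ℝ) (w : Fin n → ℂ) : ℝ :=
  MvPolynomial.eval (Sum.elim (fun i => (w i).re) fun i => (w i).im) P

/-- The function `-1 + Re ∑ b_α z_α + P('z)`, where `'z` consists of all coordinates of `z` but
the last. -/
def modelFunction {n : ℕ} (b : Fin (n + 1) → ℂ) (P : MvPolynomial (Fin n ⊕ Fin n) ℝ)
    (z : Cn (n + 1)) : ℝ :=
  -1 + (∑ α, b α * z α).re + realPolyEval P fun i => z i.castSucc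

/-- `M` is the local model at `p0` of the domain `{ρ < 0}` in `ℂ^(n+1)` furnished by the sequence
`p j → p0` with McNeal data `τ j`, `U j`: the scaled defining functions converge, uniformly on
compact sets, to `-1 + Re ∑ b_α z_α + P('z)`, whose negativity set is `M`, where `P` is a real
convex polynomial of degree at most `2m` and `2m` is the 1-type of the boundary at `p0`.
(In complex dimension one there is no `'z`, so `P` is a constant, and the 1-type is `1`.) -/
def IsLocalModel {n : ℕ} (ρ : Cn (n + 1) → ℝ) (p0 : Cn (n + 1)) (p : ℕ → Cn (n + 1))
    (τ : ℕ → Fin (n + 1) → ℝ) (U : ℕ → Cn (n + 1) ≃ₗᵢ[ℂ] Cn (n + 1))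
    (M : Set (Cn (n + 1))) : Prop :=
  ∃ (m : ℕ) (b : Fin (n + 1) → ℂ) (P : MvPolynomial (Fin n ⊕ Fin n) ℝ),
    1 ≤ m ∧ (1 ≤ n → dAngeloType ρ p0 = ((2 * m : ℕ) : ℝ≥0∞)) ∧
    P.totalDegree ≤ 2 * m ∧ ConvexOn ℝ univ (realPolyEval P) ∧
    (∀ K : Set (Cn (n + 1)), IsCompact K →
      TendstoUniformlyOn (fun j => scaledFunction ρ (p j) (τ j) (U j)) (modelFunction b P)
        atTop K) ∧
    M = {z | modelFunction b P z < 0}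

end

/-! Write ε = -ρ(p^j). Two estimates on McNeal's radii drive the convergence of the scaled
functions: for large j every radius satisfies τ_α^(2m) ≤ Cε, and the last one even satisfies τ_n ≤
Cε. The first uses finite type. On a disc about p inside D, convexity bounds |ρ| by Cε
(`exists_reflection_bound`), so the Taylor coefficients of ρ along the disc are small. One
coefficient of degree at most 2m stays away from zero (`exists_uniform_taylor_lower`), so the disc
is small (`exists_disc_radius_bound`). Hence, up to o(ε), ρ in scaled coordinates is linear in z_n
plus a polynomial of degree at most 2m in 'z (`scaledTaylor_approx`). These approximations lie in
one finite-dimensional space and are bounded on a fixed box about 0, so a subsequence converges.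
Only D is assumed convex, not ρ; the polynomial in the limit is convex because its epigraph is a
limit of convex sets (`convexOn_of_convex_sublevels`).

The exponent 2m is the D'Angelo type because on a convex domain complex lines compute it. Averaging
a holomorphic curve over small circles with nonnegative weights isolates its leading term, and
convexity transfers the order of contact of the curve to its tangent line (`lineContact_of_curve`).
The order is even since ρ ≥ 0 on tangent lines (`even_lineType`).

For the volume element, the affine scaling contributes exactly the factor ∏ τ_α²
(`kobayashiVol_mul_prod`), and it remains to prove stability at 0 under convergence of the defining
functions (`tendsto_kobayashiVol`). One inequality restricts a competitor for the limit to a smaller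
ball. The other needs bounds on competitors for the approximating domains that are uniform in j.
These come from Borel–Carathéodory and Hahn–Banach (`disc_of_holomorphic`) together with the
extremality of the radii (`disc_coord_bound`); convexity of the limit function then lets a slight
contraction push such maps into the limit domain. -/

open scoped Pointwise

/-! ### Coefficients of a polynomial from its values. -/

/-- A polynomial bounded on `[0, s]` has coefficients bounded accordingly. -/
theorem exists_coeff_bound (d : ℕ) : ∃ C : ℝ, 0 < C ∧ ∀ (a : ℕ → ℝ) (s A : ℝ), 0 ≤ s →
    (∀ t ∈ Icc 0 s, |∑ k ∈ Finset.range (d + 1), a k * t ^ k| ≤ A) →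
    ∀ k ≤ d, |a k| * s ^ k ≤ C * A := by
  -- Distinct nodes in [0, 1]: values at s * v i determine the numbers a k * s ^ k through a
  -- Vandermonde matrix independent of s.
  let v : Fin (d + 1) → ℝ := fun i => (i : ℝ) / (d + 1)
  have hv : Function.Injective v := by
    intro i j hij
    have h : ((i : ℕ) : ℝ) = (j : ℕ) := by
      have hd : (d + 1 : ℝ) ≠ 0 := by positivity
      simpa [v, div_left_inj' hd] using hij
    exact Fin.ext (by exact_mod_cast h)
  have hv01 : ∀ i, 0 ≤ v i ∧ v i ≤ 1 := by
    intro i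
    refine ⟨by positivity, ?_⟩
    rw [div_le_one (by positivity)]
    exact_mod_cast i.2.le
  let V := Matrix.vandermonde v
  have hV : IsUnit V.det := (Matrix.det_vandermonde_ne_zero_iff.mpr hv).isUnit
  refine ⟨1 + ∑ k, ∑ i, |V⁻¹ k i|, by positivity, ?_⟩
  intro a s A hs h k hk
  have hA : 0 ≤ A := (abs_nonneg _).trans (h 0 ⟨le_rfl, hs⟩)
  let b : Fin (d + 1) → ℝ := fun k => a k * s ^ (k : ℕ)
  have hVb : ∀ i, |(V.mulVec b) i| ≤ A := by
    intro i
    have := h (s * v i) ⟨mul_nonneg hs (hv01 i).1, mul_le_of_le_one_right hs (hv01 i).2⟩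
    rw [Finset.sum_range] at this
    convert this using 2
    simp only [Matrix.mulVec, dotProduct, V, Matrix.vandermonde_apply, b]
    refine Finset.sum_congr rfl fun j _ => ?_
    ring
  have hb : b = V⁻¹.mulVec (V.mulVec b) := by
    rw [Matrix.mulVec_mulVec, Matrix.nonsing_inv_mul _ hV, Matrix.one_mulVec]
  let k' : Fin (d + 1) := ⟨k, by omega⟩
  have h1 : |b k'| ≤ ∑ i, |V⁻¹ k' i| * A := by
    have h0 : b k' = ∑ i, V⁻¹ k' i * V.mulVec b i := congrFun hb k'
    rw [h0]
    refine (Finset.abs_sum_le_sum_abs (fun i => V⁻¹ k' i * V.mulVec b i) Finset.univ).trans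
      (Finset.sum_le_sum fun i _ => ?_)
    rw [abs_mul]
    exact mul_le_mul_of_nonneg_left (hVb i) (abs_nonneg _)
  have h2 : |b k'| = |a k| * s ^ k := by
    simp only [b, k', abs_mul, abs_pow, abs_of_nonneg hs]
  rw [← h2]
  refine h1.trans ?_
  rw [← Finset.sum_mul]
  refine mul_le_mul_of_nonneg_right ?_ hA
  have : ∑ i, |V⁻¹ k' i| ≤ ∑ k, ∑ i, |V⁻¹ k i| :=
    Finset.single_le_sum (f := fun k : Fin (d + 1) => ∑ i, |V⁻¹ k i|)
      (fun _ _ => by positivity) (Finset.mem_univ k')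
  linarith

/-! ### Taylor expansion along real lines. -/

section Taylor

variable {E : Type*} [NormedAddCommGroup E] [NormedSpace ℝ E]

/-- The homogeneous part of degree `k` of the Taylor expansion of `f` at `p`. -/
noncomputable def taylorTerm (f : E → ℝ) (k : ℕ) (p y : E) : ℝ :=
  ((k.factorial : ℝ))⁻¹ * iteratedFDeriv ℝ k f p (fun _ => y)

theorem taylorTerm_smul (f : E → ℝ) (k : ℕ) (p y : E) (t : ℝ) :
    taylorTerm f k p (t • y) = taylorTerm f k p y * t ^ k := by
  have := (iteratedFDeriv ℝ k f p).map_smul_univ (fun _ => t) (fun _ => y)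
  simp only [Finset.prod_const, Finset.card_univ, Fintype.card_fin, smul_eq_mul] at this
  rw [taylorTerm, this, taylorTerm]
  ring

theorem taylorTerm_zero (f : E → ℝ) (p y : E) : taylorTerm f 0 p y = f p := by
  simp [taylorTerm]

theorem taylorTerm_one (f : E → ℝ) (p y : E) : taylorTerm f 1 p y = fderiv ℝ f p y := by
  simp [taylorTerm]

theorem continuous_taylorTerm {f : E → ℝ} (hf : ContDiff ℝ ∞ f) (k : ℕ) :
    Continuous fun x : E × E => taylorTerm f k x.1 x.2 := by
  have h : Continuous (iteratedFDeriv ℝ k f) :=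
    hf.continuous_iteratedFDeriv (m := k) (by exact_mod_cast le_top)
  unfold taylorTerm
  refine continuous_const.mul ?_
  have h1 : Continuous fun x : E × E => iteratedFDeriv ℝ k f x.1 := h.comp continuous_fst
  have h2 : Continuous fun x : E × E => (fun _ : Fin k => x.2) := by fun_prop
  exact h1.eval h2

theorem iteratedDeriv_comp_line {f : E → ℝ} (hf : ContDiff ℝ ∞ f) (p y : E) (k : ℕ) :
    iteratedDeriv k (fun t : ℝ => f (p + t • y)) =
      fun t => iteratedFDeriv ℝ k f (p + t • y) (fun _ => y) := by
  induction k with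
  | zero => simp
  | succ k ih =>
    rw [iteratedDeriv_succ, ih]
    funext t
    have h1 : DifferentiableAt ℝ (iteratedFDeriv ℝ k f) (p + t • y) :=
      (hf.differentiable_iteratedFDeriv (m := k) (by exact_mod_cast WithTop.coe_lt_top _)) _
    have h2 : HasDerivAt (fun t : ℝ => p + t • y) y t := by
      simpa using ((hasDerivAt_id t).smul_const y).const_add p
    have h3 := (h1.hasFDerivAt.comp_hasDerivAt t h2)
    have h4 : HasDerivAt (fun t : ℝ => iteratedFDeriv ℝ k f (p + t • y) (fun _ => y))
        ((fderiv ℝ (iteratedFDeriv ℝ k f) (p + t • y) y) (fun _ => y)) t := by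
      exact ((ContinuousMultilinearMap.apply ℝ (fun _ : Fin k => E) ℝ
        (fun _ => y)).hasFDerivAt.comp_hasDerivAt t h3)
    rw [h4.deriv, iteratedFDeriv_succ_apply_left]
    rfl

/-- One-variable Taylor on the segment from p to p + y, which stays in the ball of radius 2 where
the next derivative is bounded. Uniformity in p matters, since later expansions are centred at
moving points. -/
theorem exists_taylor_bound [ProperSpace E] {f : E → ℝ} (hf : ContDiff ℝ ∞ f) (p0 : E) (d : ℕ) :
    ∃ C : ℝ, 0 < C ∧ ∀ p ∈ Metric.closedBall p0 1, ∀ y : E, ‖y‖ ≤ 1 →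
      |f (p + y) - ∑ k ∈ Finset.range (d + 1), taylorTerm f k p y| ≤ C * ‖y‖ ^ (d + 1) := by
  have hc : Continuous (iteratedFDeriv ℝ (d + 1) f) :=
    hf.continuous_iteratedFDeriv (m := (d + 1 : ℕ)) (by exact_mod_cast le_top)
  obtain ⟨C, hC⟩ := (isCompact_closedBall p0 2).exists_bound_of_continuousOn hc.continuousOn
  refine ⟨|C| + 1, by positivity, ?_⟩
  intro p hp y hy
  let g : ℝ → ℝ := fun t => f (p + t • y)
  have hg : ContDiff ℝ ∞ g := by
    have : ContDiff ℝ ∞ fun t : ℝ => p + t • y := by fun_prop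
    exact hf.comp this
  have hder : ∀ k, ∀ t ∈ Icc (0 : ℝ) 1, iteratedDerivWithin k g (Icc 0 1) t =
      iteratedFDeriv ℝ k f (p + t • y) (fun _ => y) := by
    intro k t ht
    rw [iteratedDerivWithin_eq_iteratedDeriv (uniqueDiffOn_Icc one_pos)
      ((hg.of_le (by exact_mod_cast le_top)).contDiffAt) ht, iteratedDeriv_comp_line hf]
  have hb : ∀ t ∈ Icc (0 : ℝ) 1, ‖iteratedDerivWithin (d + 1) g (Icc 0 1) t‖ ≤
      (|C| + 1) * ‖y‖ ^ (d + 1) := by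
    intro t ht
    rw [hder _ t ht]
    refine (ContinuousMultilinearMap.le_opNorm _ _).trans ?_
    simp only [Finset.prod_const, Finset.card_univ, Fintype.card_fin]
    refine mul_le_mul_of_nonneg_right ?_ (by positivity)
    refine (hC _ ?_).trans ((le_abs_self C).trans (by linarith))
    rw [mem_closedBall_iff_norm] at hp ⊢
    calc ‖p + t • y - p0‖ = ‖(p - p0) + t • y‖ := by congr 1; abel
      _ ≤ ‖p - p0‖ + ‖t • y‖ := norm_add_le _ _
      _ ≤ 1 + 1 * 1 := by
        rw [norm_smul, Real.norm_of_nonneg ht.1]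
        gcongr
        exact ht.2
      _ = 2 := by norm_num
  have key := taylor_mean_remainder_bound zero_le_one
    ((hg.of_le (by exact_mod_cast le_top)).contDiffOn) (right_mem_Icc.mpr zero_le_one) hb
  rw [taylor_within_apply] at key
  have e1 : g 1 = f (p + y) := by simp [g]
  rw [e1] at key
  have e2 : ∑ k ∈ Finset.range (d + 1), ((k.factorial : ℝ)⁻¹ * (1 - 0) ^ k) •
      iteratedDerivWithin k g (Icc 0 1) 0 = ∑ k ∈ Finset.range (d + 1), taylorTerm f k p y := by
    refine Finset.sum_congr rfl fun k _ => ?_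
    rw [hder k 0 ⟨le_rfl, zero_le_one⟩]
    simp [taylorTerm]
  rw [e2, Real.norm_eq_abs] at key
  refine key.trans ?_
  simp only [sub_zero, one_pow, mul_one]
  refine div_le_self (by positivity) ?_
  exact_mod_cast Nat.factorial_pos d

theorem exists_lipschitz_bound [ProperSpace E] {f : E → ℝ} (hf : ContDiff ℝ ∞ f) (p0 : E)
    (R : ℝ) : ∃ C : ℝ, 0 < C ∧ ∀ x ∈ Metric.closedBall p0 R, ∀ y ∈ Metric.closedBall p0 R,
      |f y - f x| ≤ C * ‖y - x‖ := by
  have hc : Continuous (fderiv ℝ f) := hf.continuous_fderiv (by simp)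
  obtain ⟨C, hC⟩ := (isCompact_closedBall p0 R).exists_bound_of_continuousOn hc.continuousOn
  refine ⟨|C| + 1, by positivity, fun x hx y hy => ?_⟩
  exact (convex_closedBall p0 R).norm_image_sub_le_of_norm_fderiv_le
    (fun z _ => (hf.differentiable (by simp)) z)
    (fun z hz => (hC z hz).trans ((le_abs_self C).trans (by linarith))) hx hy

/-- If `f (p + t y)` is `o(t ^ L)` as `t → 0+`, the Taylor terms up to degree `L` vanish. -/
theorem taylorTerm_eq_zero_of_littleO [ProperSpace E] {f : E → ℝ} (hf : ContDiff ℝ ∞ f) (p y : E)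
    (L : ℕ) (h : ∀ δ > 0, ∀ᶠ t in 𝓝[>] (0 : ℝ), |f (p + t • y)| ≤ δ * t ^ L) :
    ∀ k ≤ L, taylorTerm f k p y = 0 := by
  obtain ⟨C, hC, hT⟩ := exists_taylor_bound hf p L
  obtain ⟨C', hC', hcoef⟩ := exists_coeff_bound L
  intro k hk
  by_contra hne
  have hpos : 0 < |taylorTerm f k p y| := abs_pos.mpr hne
  set c := |taylorTerm f k p y| with hc
  -- The hypothesis and the Taylor remainder each cost δ s^L, so the coefficient bound gives c s^k ≤
  -- (c/2) s^L, impossible for s ≤ 1.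
  set δ := c / (4 * C') with hδ
  have hδ0 : 0 < δ := by positivity
  obtain ⟨s1, hs1, H⟩ := mem_nhdsGT_iff_exists_Ioo_subset.mp (h δ hδ0)
  have hs1 : 0 < s1 := hs1
  set Y := C * ‖y‖ ^ (L + 1) with hY
  have hY0 : 0 ≤ Y := by positivity
  obtain ⟨s, hs0, hss1, hs_one, hsy, hsY⟩ : ∃ s : ℝ, 0 < s ∧ s < s1 ∧ s ≤ 1 ∧ s * ‖y‖ ≤ 1 ∧
      s * Y ≤ δ := by
    refine ⟨min (min (s1 / 2) 1) (min (1 / (‖y‖ + 1)) (δ / (Y + 1))), by positivity, ?_, ?_, ?_, ?_⟩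
    · exact (min_le_left _ _).trans_lt ((min_le_left _ _).trans_lt (by linarith))
    · exact (min_le_left _ _).trans (min_le_right _ _)
    · calc _ ≤ (1 / (‖y‖ + 1)) * ‖y‖ := by
            gcongr; exact (min_le_right _ _).trans (min_le_left _ _)
        _ ≤ 1 := by rw [div_mul_eq_mul_div, div_le_one (by positivity)]; linarith
    · calc _ ≤ (δ / (Y + 1)) * Y := by
            gcongr; exact (min_le_right _ _).trans (min_le_right _ _)
        _ ≤ δ := by
          rw [div_mul_eq_mul_div, div_le_iff₀ (by positivity)]
          nlinarith
  have hbound : ∀ t ∈ Icc 0 s, |∑ k ∈ Finset.range (L + 1), taylorTerm f k p y * t ^ k| ≤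
      2 * δ * s ^ L := by
    have hIoc : ∀ t ∈ Ioc 0 s, |∑ k ∈ Finset.range (L + 1), taylorTerm f k p y * t ^ k| ≤
        2 * δ * s ^ L := by
      intro t ht
      have h1 : |f (p + t • y)| ≤ δ * t ^ L := H ⟨ht.1, ht.2.trans_lt hss1⟩
      have hty : ‖t • y‖ = t * ‖y‖ := by rw [norm_smul, Real.norm_of_nonneg ht.1.le]
      have h2 := hT p (Metric.mem_closedBall_self zero_le_one) (t • y) (by
        rw [hty]
        exact (mul_le_mul_of_nonneg_right ht.2 (norm_nonneg _)).trans hsy)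
      simp only [taylorTerm_smul] at h2
      rw [hty, mul_pow] at h2
      have h3 : C * (t ^ (L + 1) * ‖y‖ ^ (L + 1)) ≤ δ * t ^ L := by
        calc _ = (t * Y) * t ^ L := by rw [hY]; ring
          _ ≤ δ * t ^ L := by
            refine mul_le_mul_of_nonneg_right ?_ (pow_nonneg ht.1.le _)
            exact (mul_le_mul_of_nonneg_right ht.2 hY0).trans hsY
      have h4 : δ * t ^ L ≤ δ * s ^ L := by
        gcongr
        · exact ht.1.le
        · exact ht.2
      rw [abs_le] at h1 h2 ⊢
      constructor <;> linarith
    have hclosed : IsClosed {t : ℝ | |∑ k ∈ Finset.range (L + 1), taylorTerm f k p y * t ^ k| ≤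
        2 * δ * s ^ L} := isClosed_le (by fun_prop) continuous_const
    intro t ht
    have : closure (Ioc 0 s) ⊆ _ := hclosed.closure_subset_iff.mpr hIoc
    rw [closure_Ioc hs0.ne] at this
    exact this ht
  have h5 := hcoef _ s _ hs0.le hbound k hk
  rw [← hc] at h5
  have h6 : C' * (2 * δ * s ^ L) = c / 2 * s ^ L := by
    rw [hδ]; field_simp; ring
  rw [h6] at h5
  have h7 : s ^ L ≤ s ^ k := pow_le_pow_of_le_one hs0.le hs_one hk
  have h8 : 0 < s ^ L := by positivity
  nlinarith

end Taylor

/-! ### Defining functions near a boundary point. -/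

section RealGeometry

variable {E : Type*} [NormedAddCommGroup E] [NormedSpace ℝ E] {ρ : E → ℝ} {D : Set E} {p0 : E}

theorem isOpen_of_sublevel (hρ : ContDiff ℝ ∞ ρ) (hD : D = {z | ρ z < 0}) : IsOpen D := by
  rw [hD]; exact isOpen_lt hρ.continuous continuous_const

theorem defining_eq_zero (hρ : ContDiff ℝ ∞ ρ) (hD : D = {z | ρ z < 0}) (hp0 : p0 ∈ frontier D) :
    ρ p0 = 0 := by
  have h1 : p0 ∉ D := by
    rw [(isOpen_of_sublevel hρ hD).frontier_eq] at hp0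
    exact hp0.2
  have h2 : closure D ⊆ {z | ρ z ≤ 0} :=
    (isClosed_le hρ.continuous continuous_const).closure_subset_iff.mpr fun z hz => by
      rw [hD] at hz; exact le_of_lt (show ρ z < 0 from hz)
  have h3 : ρ p0 ≤ 0 := h2 (frontier_subset_closure hp0)
  have h4 : ¬ ρ p0 < 0 := by rw [hD] at h1; exact h1
  exact le_antisymm h3 (not_lt.mp h4)

/-- Strict differentiability: both points may move while the derivative stays frozen at `p0`, and
the error is relative to their distance. -/
theorem exists_strict_approx (hρ : ContDiff ℝ ∞ ρ) (p0 : E) {c : ℝ} (hc : 0 < c) :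
    ∃ δ > 0, ∀ x ∈ Metric.ball p0 δ, ∀ y ∈ Metric.ball p0 δ,
      |ρ x - ρ y - fderiv ℝ ρ p0 (x - y)| ≤ c * ‖x - y‖ := by
  have h : HasStrictFDerivAt ρ (fderiv ℝ ρ p0) p0 :=
    hρ.contDiffAt.hasStrictFDerivAt (by simp)
  have h1 := h.isLittleO.def hc
  rw [nhds_prod_eq, Filter.eventually_prod_self_iff'] at h1
  obtain ⟨t, ht, H⟩ := h1
  obtain ⟨δ, hδ, hball⟩ := Metric.mem_nhds_iff.mp ht
  exact ⟨δ, hδ, fun x hx y hy => H x (hball hx) y (hball hy)⟩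

theorem exists_transversal (hreg : fderiv ℝ ρ p0 ≠ 0) : ∃ η : E, fderiv ℝ ρ p0 η = 1 := by
  obtain ⟨v, hv⟩ : ∃ v, fderiv ℝ ρ p0 v ≠ 0 := by
    by_contra! h
    exact hreg (by ext v; simpa using h v)
  exact ⟨(fderiv ℝ ρ p0 v)⁻¹ • v, by simp [hv]⟩

/-- Strict approximation with constant 1/(2‖η‖) loses at most half of the unit slope along η. This
converts displacements along η into changes of ρ, and so into entering or leaving D. -/
theorem exists_growth (hρ : ContDiff ℝ ∞ ρ) {η : E} (hη : fderiv ℝ ρ p0 η = 1) :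
    ∃ δ > 0, ∀ z ∈ Metric.ball p0 δ, ∀ a : ℝ, 0 ≤ a → z + a • η ∈ Metric.ball p0 δ →
      ρ z + a / 2 ≤ ρ (z + a • η) := by
  have hη0 : 0 < ‖η‖ := by
    rw [norm_pos_iff]; rintro rfl; simp at hη
  obtain ⟨δ, hδ, H⟩ := exists_strict_approx hρ p0 (c := 1 / (2 * ‖η‖)) (by positivity)
  refine ⟨δ, hδ, fun z hz a ha hza => ?_⟩
  have h := H _ hza _ hz
  rw [add_sub_cancel_left, map_smul, hη, norm_smul, Real.norm_of_nonneg ha] at h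
  have e : 1 / (2 * ‖η‖) * (a * ‖η‖) = a / 2 := by field_simp
  rw [e, abs_le, smul_eq_mul, mul_one] at h
  linarith [h.1]

theorem tendsto_line_quotient (hρ : ContDiff ℝ ∞ ρ) (h0 : ρ p0 = 0) (y : E) :
    Tendsto (fun t : ℝ => ρ (p0 + t • y) / t) (𝓝[>] 0) (𝓝 (fderiv ℝ ρ p0 y)) := by
  have h2 : HasDerivAt (fun t : ℝ => p0 + t • y) y 0 := by
    simpa using ((hasDerivAt_id (0 : ℝ)).smul_const y).const_add p0
  have h1 : HasFDerivAt ρ (fderiv ℝ ρ p0) (p0 + (0 : ℝ) • y) := by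
    rw [zero_smul, add_zero]
    exact (hρ.differentiable (by simp) p0).hasFDerivAt
  have h3 := (h1.comp_hasDerivAt 0 h2).tendsto_slope_zero_right
  refine h3.congr fun t => ?_
  simp [h0, div_eq_inv_mul]

/-- Points of the real tangent hyperplane lie outside a convex domain. -/
theorem nonneg_of_tangent (hρ : ContDiff ℝ ∞ ρ) (hD : D = {z | ρ z < 0}) (hconv : Convex ℝ D)
    (hp0 : p0 ∈ frontier D) (hreg : fderiv ℝ ρ p0 ≠ 0) {y : E} (hy : fderiv ℝ ρ p0 y = 0) :
    0 ≤ ρ (p0 + y) := by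
  by_contra! hneg
  have h0 := defining_eq_zero hρ hD hp0
  have hopen := isOpen_of_sublevel hρ hD
  obtain ⟨η, hη⟩ := exists_transversal hreg
  have hcont : Continuous fun a : ℝ => ρ (p0 + (y + a • η)) := hρ.continuous.comp (by fun_prop)
  -- Openness allows a small outward push inside D. The segment from `p0` to the pushed point then
  -- lies in D, forcing a nonpositive slope, whereas the slope is a > 0.
  have hev : ∀ᶠ a : ℝ in 𝓝 0, ρ (p0 + (y + a • η)) < 0 := by
    refine hcont.continuousAt.eventually_lt continuousAt_const ?_
    simpa using hneg
  obtain ⟨a, ha, hapos⟩ := ((hev.filter_mono nhdsWithin_le_nhds).and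
    (self_mem_nhdsWithin (a := (0 : ℝ)) (s := Ioi 0))).exists
  have hapos : 0 < a := hapos
  have hlim := tendsto_line_quotient hρ h0 (y + a • η)
  have hle : fderiv ℝ ρ p0 (y + a • η) ≤ 0 := by
    refine le_of_tendsto hlim ?_
    have h1 : ∀ᶠ t : ℝ in 𝓝[>] 0, t < 1 :=
      (eventually_lt_nhds one_pos).filter_mono nhdsWithin_le_nhds
    filter_upwards [h1, self_mem_nhdsWithin] with t ht ht0
    have ht0 : 0 < t := ht0
    refine div_nonpos_of_nonpos_of_nonneg ?_ ht0.le
    have hq : p0 + (y + a • η) ∈ interior D := by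
      rw [hopen.interior_eq, hD]; exact ha
    have hmem := hconv.add_smul_sub_mem_interior' (frontier_subset_closure hp0) hq ⟨ht0, ht.le⟩
    rw [hopen.interior_eq, hD, add_sub_cancel_left] at hmem
    exact le_of_lt hmem
  rw [map_add, map_smul, hy, hη] at hle
  simp at hle
  linarith

end RealGeometry

/-! ### Averaging holomorphic curves over circles. -/

/-- Discrete weights on the `N`-th roots of unity extracting the coefficient of degree `k`. -/
theorem exists_averaging_weights {k N : ℕ} (hk : 1 ≤ k) (hN : 2 * k < N) :
    ∃ (c : Fin N → ℝ) (z : Fin N → ℂ), (∀ i, 0 ≤ c i) ∧ ∑ i, c i = 1 ∧ (∀ i, ‖z i‖ = 1) ∧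
      ∀ l, k ≤ l → l + k < N → ∑ i, (c i : ℂ) * z i ^ l = if l = k then 1 / 2 else 0 := by
  have hN0 : N ≠ 0 := by omega
  have hζ := Complex.isPrimitiveRoot_exp N hN0
  set ζ := Complex.exp (2 * Real.pi * Complex.I / N) with hζdef
  have hnorm : ‖ζ‖ = 1 := hζ.norm'_eq_one hN0
  have hsum : ∀ m : ℕ, ∑ i : Fin N, (ζ ^ (i : ℕ)) ^ m = if N ∣ m then (N : ℂ) else 0 := by
    intro m
    have h1 : ∑ i : Fin N, (ζ ^ (i : ℕ)) ^ m = ∑ i ∈ Finset.range N, (ζ ^ m) ^ i := by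
      rw [Finset.sum_range]
      exact Finset.sum_congr rfl fun i _ => by rw [← pow_mul, ← pow_mul, mul_comm]
    rw [h1]
    split_ifs with h
    · rw [(hζ.pow_eq_one_iff_dvd m).mpr h]; simp
    · have hne : ζ ^ m ≠ 1 := fun h' => h ((hζ.pow_eq_one_iff_dvd m).mp h')
      rw [geom_sum_eq hne, ← pow_mul, mul_comm, pow_mul, hζ.pow_eq_one]
      simp
  have hinv : ∀ i : ℕ, (starRingEnd ℂ) ((ζ ^ i) ^ k) = (ζ ^ i) ^ (N - k) := by
    intro i
    have h1 : ‖(ζ ^ i) ^ k‖ = 1 := by simp [hnorm]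
    rw [← Complex.inv_eq_conj h1]
    refine inv_eq_of_mul_eq_one_right ?_
    rw [← pow_add, show k + (N - k) = N by omega, ← pow_mul, mul_comm, pow_mul, hζ.pow_eq_one,
      one_pow]
  -- A nonnegative trigonometric kernel. Its frequency -k, written as the power N - k, pairs with
  -- z^k to give 1/2; the frequencies 0 and k meet no power l with k ≤ l < N - k.
  let c : Fin N → ℝ := fun i => (1 + ((ζ ^ (i : ℕ)) ^ k).re) / N
  have hc : ∀ i, (c i : ℂ) =
      (1 + ((ζ ^ (i : ℕ)) ^ k + (ζ ^ (i : ℕ)) ^ (N - k)) / 2) / N := by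
    intro i
    rw [← hinv, Complex.add_conj]
    simp [c]
  have hmul : ∀ l, ∑ i, (c i : ℂ) * (ζ ^ (i : ℕ)) ^ l =
      ((if N ∣ l then (N : ℂ) else 0) + ((if N ∣ k + l then (N : ℂ) else 0) +
        (if N ∣ N - k + l then (N : ℂ) else 0)) / 2) / N := by
    intro l
    rw [← hsum, ← hsum, ← hsum, ← Finset.sum_add_distrib, Finset.sum_div,
      ← Finset.sum_add_distrib, Finset.sum_div]
    refine Finset.sum_congr rfl fun i _ => ?_
    rw [hc, pow_add, pow_add]
    ring
  have hNC : (N : ℂ) ≠ 0 := by exact_mod_cast hN0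
  refine ⟨c, fun i => ζ ^ (i : ℕ), ?_, ?_, ?_, ?_⟩
  · intro i
    refine div_nonneg ?_ (by positivity)
    have := (abs_le.mp (Complex.abs_re_le_norm ((ζ ^ (i : ℕ)) ^ k))).1
    simp only [norm_pow, hnorm, one_pow] at this
    linarith
  · have h := hmul 0
    have h1 : ¬ N ∣ k + 0 := fun h => by have := Nat.le_of_dvd (by omega) h; omega
    have h2 : ¬ N ∣ N - k + 0 := fun h => by have := Nat.le_of_dvd (by omega) h; omega
    simp only [pow_zero, mul_one, dvd_zero, if_true, h1, h2, if_false] at h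
    have : ((∑ i, c i : ℝ) : ℂ) = 1 := by
      push_cast
      rw [h]; field_simp; simp
    exact_mod_cast this
  · intro i; simp [hnorm]
  · intro l hl hlN
    rw [hmul]
    have h1 : ¬ N ∣ l := fun h => by have := Nat.le_of_dvd (by omega) h; omega
    have h2 : ¬ N ∣ k + l := fun h => by have := Nat.le_of_dvd (by omega) h; omega
    have h3 : N ∣ N - k + l ↔ l = k := by
      constructor
      · intro h
        have e : N - k + l = N + (l - k) := by omega
        rw [e, Nat.dvd_add_right (dvd_refl N)] at h
        by_contra hne
        have := Nat.le_of_dvd (by omega) h; omega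
      · rintro rfl
        rw [show N - l + l = N by omega]
    simp only [h1, h2, h3, if_false]
    split_ifs
    · field_simp; simp
    · simp

theorem ofReal_smul_Cn {d : ℕ} (r : ℝ) (x : Cn d) : (r : ℂ) • x = r • x := by
  ext i; simp

/-- Weighted averages of a curve over small circles isolate its leading coefficient. -/
theorem exists_curve_average {d : ℕ} {γ g : ℂ → Cn d} {p0 : Cn d} {k M : ℕ} (hk : 1 ≤ k)
    (hkM : k < M) (hg : AnalyticAt ℂ g 0) (hγ : ∀ᶠ t in 𝓝 0, γ t = p0 + t ^ k • g t) (θ : ℂ) :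
    ∃ (N : ℕ) (c : Fin N → ℝ) (z : Fin N → ℂ) (C s0 : ℝ), (∀ i, 0 ≤ c i) ∧ ∑ i, c i = 1 ∧
      (∀ i, ‖z i‖ = 1) ∧ 0 < s0 ∧ ∀ s : ℝ, 0 < s → s < s0 →
        ‖∑ i, c i • γ (s * θ * z i) - (p0 + ((s * θ) ^ k / 2) • g 0)‖ ≤ C * s ^ M := by
  -- With M + k nodes the weights kill all powers from k + 1 to M - 1, leaving the leading term and
  -- an error of order M.
  obtain ⟨c, z, hc, hc1, hz, hcz⟩ := exists_averaging_weights (N := M + k) hk (by omega)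
  obtain ⟨P, hP⟩ := hg
  obtain ⟨C1, hC1⟩ := (hP.isBigO_sub_partialSum_pow (M - k)).bound
  have hcoef : P.coeff 0 = g 0 := by simpa using hP.coeff_zero 1
  obtain ⟨r, hr, hball⟩ := Metric.eventually_nhds_iff.mp (hC1.and hγ)
  have hθ : 0 < ‖θ‖ + 1 := by positivity
  refine ⟨M + k, c, z, C1 * ‖θ‖ ^ M, r / (‖θ‖ + 1), hc, hc1, hz, by positivity, ?_⟩
  intro s hs hsr
  have ht : ∀ i, ‖(s : ℂ) * θ * z i‖ = s * ‖θ‖ := by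
    intro i; simp [hz, abs_of_pos hs]
  have hsmall : s * ‖θ‖ < r := by
    rw [lt_div_iff₀ hθ] at hsr
    nlinarith
  let e : Fin (M + k) → Cn d := fun i => (s * θ * z i) ^ k •
    (g (s * θ * z i) - ∑ l ∈ Finset.range (M - k), (s * θ * z i) ^ l • P.coeff l)
  have he : ∀ i, ‖e i‖ ≤ C1 * ‖θ‖ ^ M * s ^ M := by
    intro i
    have h1 := (hball (y := s * θ * z i) (by rw [dist_zero_right, ht]; exact hsmall)).1
    have h2 : P.partialSum (M - k) (s * θ * z i) =
        ∑ l ∈ Finset.range (M - k), (s * θ * z i) ^ l • P.coeff l := by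
      simp [FormalMultilinearSeries.partialSum]
    rw [zero_add, h2, Real.norm_of_nonneg (by positivity), ht] at h1
    have h3 : (s * ‖θ‖) ^ k * (s * ‖θ‖) ^ (M - k) = ‖θ‖ ^ M * s ^ M := by
      rw [← pow_add, Nat.add_sub_cancel' hkM.le, mul_pow, mul_comm]
    calc ‖e i‖ = (s * ‖θ‖) ^ k * ‖g (s * θ * z i) -
          ∑ l ∈ Finset.range (M - k), (s * θ * z i) ^ l • P.coeff l‖ := by
          simp only [e]; rw [norm_smul, norm_pow, ht]
      _ ≤ (s * ‖θ‖) ^ k * (C1 * (s * ‖θ‖) ^ (M - k)) := by gcongr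
      _ = _ := by rw [mul_left_comm, h3, mul_assoc]
  have hγi : ∀ i, γ (s * θ * z i) =
      p0 + (∑ l ∈ Finset.range (M - k), (s * θ * z i) ^ (k + l) • P.coeff l + e i) := by
    intro i
    rw [(hball (y := s * θ * z i) (by rw [dist_zero_right, ht]; exact hsmall)).2]
    simp only [e, smul_sub, Finset.smul_sum, smul_smul, pow_add]
    abel
  have hsum : ∑ i, c i • γ (s * θ * z i) - (p0 + ((s * θ) ^ k / 2) • g 0) =
      ∑ i, c i • e i := by
    simp only [hγi, smul_add, Finset.sum_add_distrib]
    rw [← Finset.sum_smul, hc1, one_smul]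
    have h4 : ∑ i, c i • ∑ l ∈ Finset.range (M - k), (s * θ * z i) ^ (k + l) • P.coeff l =
        ((s * θ) ^ k / 2) • g 0 := by
      simp only [← ofReal_smul_Cn, Finset.smul_sum, smul_smul]
      rw [Finset.sum_comm]
      have h5 : ∀ l ∈ Finset.range (M - k),
          ∑ i, ((c i : ℂ) * (s * θ * z i) ^ (k + l)) • P.coeff l =
          if l = 0 then ((s * θ) ^ k / 2) • g 0 else 0 := by
        intro l hl
        rw [Finset.mem_range] at hl
        rw [← Finset.sum_smul]
        have h6 : ∑ i, (c i : ℂ) * (s * θ * z i) ^ (k + l) =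
            (s * θ) ^ (k + l) * ∑ i, (c i : ℂ) * z i ^ (k + l) := by
          rw [Finset.mul_sum]
          exact Finset.sum_congr rfl fun i _ => by rw [mul_pow (_ * _)]; ring
        rw [h6, hcz (k + l) (by omega) (by omega)]
        by_cases h0 : l = 0
        · subst h0; simp [hcoef, div_eq_mul_inv]
        · simp [h0]
      rw [Finset.sum_congr rfl h5, Finset.sum_ite_eq' (Finset.range (M - k)) 0]
      rw [if_pos (Finset.mem_range.mpr (by omega))]
    rw [h4]
    abel
  rw [hsum]
  calc ‖∑ i, c i • e i‖ ≤ ∑ i, ‖c i • e i‖ := norm_sum_le _ _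
    _ ≤ ∑ i, c i * (C1 * ‖θ‖ ^ M * s ^ M) := by
      refine Finset.sum_le_sum fun i _ => ?_
      rw [norm_smul, Real.norm_of_nonneg (hc i)]
      exact mul_le_mul_of_nonneg_left (he i) (hc i)
    _ = _ := by rw [← Finset.sum_mul, hc1, one_mul]

/-! ### The 1-type of a convex hypersurface via complex lines. -/

section Curves

variable {d : ℕ} {ρ : Cn d → ℝ} {D : Set (Cn d)} {p0 : Cn d}

/-- For convex domains, a curve with high order of contact has a tangent line with high order
of contact: an upper bound for `ρ` along the line. -/
theorem exists_line_upper_bound (hρ : ContDiff ℝ ∞ ρ) (hD : D = {z | ρ z < 0})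
    (hconv : Convex ℝ D) (hreg : fderiv ℝ ρ p0 ≠ 0)
    {γ g : ℂ → Cn d} {k M : ℕ} (hk : 1 ≤ k)
    (hkM : k < M) (hg : AnalyticAt ℂ g 0) (hγ : ∀ᶠ t in 𝓝 0, γ t = p0 + t ^ k • g t)
    (hO : (ρ ∘ γ) =O[𝓝 0] fun t : ℂ => ‖t‖ ^ M) (θ : ℂ) :
    ∃ C > 0, ∃ s0 > 0, ∀ s : ℝ, 0 < s → s < s0 →
      ρ (p0 + ((s * θ) ^ k / 2) • g 0) ≤ C * s ^ M := by
  obtain ⟨η, hη⟩ := exists_transversal hreg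
  obtain ⟨δ, hδ, hgrow⟩ := exists_growth hρ hη
  obtain ⟨N, c, z, C2, s2, hc, hc1, hz, hs2, havg⟩ := exists_curve_average hk hkM hg hγ θ
  obtain ⟨K, hK, hLip⟩ := exists_lipschitz_bound hρ p0 δ
  obtain ⟨C1, hC1pos, hC1⟩ := hO.exists_pos
  -- On the curve ρ is at most C1 ‖θ‖^M s^M, and moving inward by A s^M along η lowers it by at
  -- least A s^M / 2, enough to land in D.
  set A := 2 * (C1 * ‖θ‖ ^ M) + 1 with hA
  have hApos : 0 < A := by positivity
  have hM0 : M ≠ 0 := by omega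
  have hγ0 : γ 0 = p0 := by simpa [show k ≠ 0 by omega] using hγ.self_of_nhds
  have hγcont : ContinuousAt γ 0 := by
    have : ContinuousAt (fun t : ℂ => p0 + t ^ k • g t) 0 := by
      have := hg.continuousAt
      fun_prop
    exact this.congr (hγ.mono fun t ht => ht.symm)
  -- all relevant points stay close to `p0`
  have hnear1 : ∀ᶠ s : ℝ in 𝓝[>] 0, ∀ i, γ (s * θ * z i) ∈ Metric.ball p0 δ ∧
      γ (s * θ * z i) - (A * s ^ M) • η ∈ Metric.ball p0 δ ∧
      ‖ρ (γ (s * θ * z i))‖ ≤ C1 * ‖θ‖ ^ M * s ^ M := by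
    rw [eventually_all]
    intro i
    have hline : Tendsto (fun s : ℝ => (s : ℂ) * θ * z i) (𝓝 0) (𝓝 0) := by
      have : Continuous fun s : ℝ => (s : ℂ) * θ * z i := by fun_prop
      simpa using this.tendsto 0
    have hlim : Tendsto (fun s : ℝ => γ (s * θ * z i)) (𝓝 0) (𝓝 p0) := by
      rw [← hγ0]; exact hγcont.tendsto.comp hline
    have hpow : Tendsto (fun s : ℝ => (A * s ^ M) • η) (𝓝 0) (𝓝 0) := by
      have : Continuous fun s : ℝ => (A * s ^ M) • η := by fun_prop
      simpa [hM0] using this.tendsto 0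
    have e1 := hlim.eventually (Metric.ball_mem_nhds p0 hδ)
    have e2 : ∀ᶠ s : ℝ in 𝓝 0, γ (s * θ * z i) - (A * s ^ M) • η ∈ Metric.ball p0 δ := by
      have := hlim.sub hpow
      rw [sub_zero] at this
      exact this.eventually (Metric.ball_mem_nhds p0 hδ)
    have e3 := hline.eventually hC1.bound
    filter_upwards [e1.filter_mono nhdsWithin_le_nhds, e2.filter_mono nhdsWithin_le_nhds,
      e3.filter_mono nhdsWithin_le_nhds, self_mem_nhdsWithin] with s h1 h2 h3 hs
    refine ⟨h1, h2, h3.trans (le_of_eq ?_)⟩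
    have hs : 0 < s := hs
    simp [hz, abs_of_pos hs]
    ring
  have hnear2 : ∀ᶠ s : ℝ in 𝓝[>] 0, p0 + ((s * θ) ^ k / 2) • g 0 ∈ Metric.ball p0 δ := by
    have : Continuous fun s : ℝ => p0 + (((s : ℂ) * θ) ^ k / 2) • g 0 := by fun_prop
    have h := this.tendsto 0
    simp only [Complex.ofReal_zero, zero_mul, zero_pow (show k ≠ 0 by omega), zero_div, zero_smul,
      add_zero] at h
    exact (h.eventually (Metric.ball_mem_nhds p0 hδ)).filter_mono nhdsWithin_le_nhds
  obtain ⟨s1, hs1, H⟩ := mem_nhdsGT_iff_exists_Ioo_subset.mp (hnear1.and hnear2)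
  have hs1 : 0 < s1 := hs1
  have hC2 : 0 ≤ |C2| := abs_nonneg _
  refine ⟨K * (|C2| + A * ‖η‖) + 1, by positivity, min s1 s2, lt_min hs1 hs2, ?_⟩
  intro s hs hss
  obtain ⟨h1, h2⟩ := H ⟨hs, hss.trans_le (min_le_left _ _)⟩
  have hsM : 0 < s ^ M := by positivity
  have hx : ∀ i, γ (s * θ * z i) - (A * s ^ M) • η ∈ D := by
    intro i
    have h3 := hgrow _ (h1 i).2.1 (A * s ^ M) (by positivity)
      (by rw [sub_add_cancel]; exact (h1 i).1)
    rw [sub_add_cancel] at h3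
    have h4 := (abs_le.mp (h1 i).2.2).2
    rw [hD]
    show ρ _ < 0
    have : A * s ^ M / 2 = C1 * ‖θ‖ ^ M * s ^ M + s ^ M / 2 := by rw [hA]; ring
    linarith
  -- Convexity enters here: the mean of the shifted points lies in D and is within O(s^M) of the
  -- point on the line.
  set y := ∑ i, c i • (γ (s * θ * z i) - (A * s ^ M) • η) with hy
  have hyD : y ∈ D := hconv.sum_mem (fun i _ => hc i) hc1 fun i _ => hx i
  have hyball : y ∈ Metric.ball p0 δ :=
    (convex_ball p0 δ).sum_mem (fun i _ => hc i) hc1 fun i _ => (h1 i).2.1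
  have hyeq : y = ∑ i, c i • γ (s * θ * z i) - (A * s ^ M) • η := by
    simp only [hy, smul_sub, Finset.sum_sub_distrib]
    rw [← Finset.sum_smul, hc1, one_smul]
  have hdist : ‖(p0 + ((s * θ) ^ k / 2) • g 0) - y‖ ≤ (|C2| + A * ‖η‖) * s ^ M := by
    have h5 := havg s hs (hss.trans_le (min_le_right _ _))
    rw [hyeq, norm_sub_rev]
    calc ‖∑ i, c i • γ (s * θ * z i) - (A * s ^ M) • η - (p0 + ((s * θ) ^ k / 2) • g 0)‖
        = ‖(∑ i, c i • γ (s * θ * z i) - (p0 + ((s * θ) ^ k / 2) • g 0)) - (A * s ^ M) • η‖ := by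
          congr 1; abel
      _ ≤ C2 * s ^ M + A * s ^ M * ‖η‖ := by
          refine (norm_sub_le _ _).trans (add_le_add h5 ?_)
          rw [norm_smul, Real.norm_of_nonneg (by positivity)]
      _ ≤ |C2| * s ^ M + A * s ^ M * ‖η‖ := by gcongr; exact le_abs_self _
      _ = _ := by ring
  have h6 := (abs_le.mp (hLip y (Metric.ball_subset_closedBall hyball) _
    (Metric.ball_subset_closedBall h2))).2
  have h7 : ρ y < 0 := by rw [hD] at hyD; exact hyD
  have h8 := mul_le_mul_of_nonneg_left hdist hK.le
  nlinarith

/-- The complex line through `p0` in direction `v` has order of contact at least `K` with the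
hypersurface defined by `ρ`. -/
def LineContact (ρ : Cn d → ℝ) (p0 : Cn d) (K : ℕ) (v : Cn d) : Prop :=
  ∀ θ : ℂ, ∀ k < K, taylorTerm ρ k p0 (θ • v) = 0

/-- With s^k = 2t, the upper bound C s^(Lk+1) on the line is o(t^L). Since L ≥ 1, all slopes along
the complex line are nonpositive, hence zero on replacing θ by -θ. The line is therefore tangent,
convexity gives ρ ≥ 0 on it, and the one-sided bound becomes two-sided. -/
theorem lineContact_of_curve (hρ : ContDiff ℝ ∞ ρ) (hD : D = {z | ρ z < 0})
    (hconv : Convex ℝ D) (hp0 : p0 ∈ frontier D) (hreg : fderiv ℝ ρ p0 ≠ 0)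
    {γ g : ℂ → Cn d} {k L : ℕ} (hk : 1 ≤ k) (hL : 1 ≤ L)
    (hg : AnalyticAt ℂ g 0) (hγ : ∀ᶠ t in 𝓝 0, γ t = p0 + t ^ k • g t)
    (hO : (ρ ∘ γ) =O[𝓝 0] fun t : ℂ => ‖t‖ ^ (L * k + 1)) :
    LineContact ρ p0 (L + 1) (g 0) := by
  have h0 := defining_eq_zero hρ hD hp0
  have upper : ∀ θ : ℂ, ∀ δ > 0, ∀ᶠ t in 𝓝[>] (0 : ℝ), ρ (p0 + t • θ • g 0) ≤ δ * t ^ L := by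
    intro θ δ hδ
    obtain ⟨θ', hθ'⟩ := IsAlgClosed.exists_pow_nat_eq θ (n := k) (by omega)
    obtain ⟨C, hC, s0, hs0, H⟩ := exists_line_upper_bound hρ hD hconv hreg hk
      (show k < L * k + 1 by nlinarith) hg hγ hO θ'
    have hkR : (0 : ℝ) < 1 / k := by
      have : (0 : ℝ) < k := by exact_mod_cast hk
      positivity
    have hlim : Tendsto (fun t : ℝ => (2 * t) ^ (1 / k : ℝ)) (𝓝[>] 0) (𝓝 0) := by
      have hc : ContinuousAt (fun t : ℝ => (2 * t) ^ (1 / k : ℝ)) 0 := by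
        refine ContinuousAt.rpow_const (by fun_prop) (Or.inr hkR.le)
      have := hc.tendsto
      rw [mul_zero, Real.zero_rpow hkR.ne'] at this
      exact this.mono_left nhdsWithin_le_nhds
    have hb : 0 < min s0 (δ / (C * 2 ^ L)) := by positivity
    filter_upwards [hlim.eventually (eventually_lt_nhds hb), self_mem_nhdsWithin] with t ht ht0
    have ht0 : 0 < t := ht0
    set s := (2 * t) ^ (1 / k : ℝ) with hs
    have hspos : 0 < s := by positivity
    have hsk : s ^ k = 2 * t := by
      rw [hs, one_div, Real.rpow_inv_natCast_pow (by positivity) (by omega)]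
    have h1 := H s hspos (ht.trans_le (min_le_left _ _))
    have e1 : (((s : ℂ) * θ') ^ k / 2) • g 0 = t • θ • g 0 := by
      rw [mul_pow, hθ', ← Complex.ofReal_pow, hsk, ← ofReal_smul_Cn, smul_smul]
      congr 1
      push_cast; ring
    have e2 : s ^ (L * k + 1) = s * (2 ^ L * t ^ L) := by
      rw [pow_succ, mul_comm L k, pow_mul, hsk, mul_pow]; ring
    rw [e1, e2] at h1
    refine h1.trans ?_
    have h2 : s * (C * 2 ^ L) ≤ δ := by
      rw [← le_div_iff₀ (by positivity)]
      exact ht.le.trans (min_le_right _ _)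
    calc C * (s * (2 ^ L * t ^ L)) = (s * (C * 2 ^ L)) * t ^ L := by ring
      _ ≤ δ * t ^ L := by gcongr
  have hle : ∀ θ : ℂ, fderiv ℝ ρ p0 (θ • g 0) ≤ 0 := by
    intro θ
    refine le_of_forall_pos_le_add fun δ hδ => ?_
    rw [zero_add]
    refine le_of_tendsto (tendsto_line_quotient hρ h0 (θ • g 0)) ?_
    have h1 : ∀ᶠ t : ℝ in 𝓝[>] 0, t < 1 :=
      (eventually_lt_nhds one_pos).filter_mono nhdsWithin_le_nhds
    filter_upwards [upper θ δ hδ, h1, self_mem_nhdsWithin] with t ht ht1 ht0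
    have ht0 : 0 < t := ht0
    rw [div_le_iff₀ ht0]
    refine ht.trans (mul_le_mul_of_nonneg_left ?_ hδ.le)
    calc t ^ L ≤ t ^ 1 := pow_le_pow_of_le_one ht0.le ht1.le hL
      _ = t := pow_one t
  have heq : ∀ θ : ℂ, fderiv ℝ ρ p0 (θ • g 0) = 0 := by
    intro θ
    refine le_antisymm (hle θ) ?_
    have := hle (-θ)
    rw [neg_smul, map_neg] at this
    linarith
  intro θ j hj
  refine taylorTerm_eq_zero_of_littleO hρ p0 (θ • g 0) L ?_ j (by omega)
  intro δ hδ
  filter_upwards [upper θ δ hδ] with t ht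
  have h1 : 0 ≤ ρ (p0 + t • θ • g 0) := by
    refine nonneg_of_tangent hρ hD hconv hp0 hreg ?_
    rw [map_smul, heq, smul_zero]
  rwa [abs_of_nonneg h1]

theorem isBigO_of_lineContact (hρ : ContDiff ℝ ∞ ρ) {K : ℕ} {v : Cn d}
    (h : LineContact ρ p0 K v) :
    (ρ ∘ fun t : ℂ => p0 + t • v) =O[𝓝 0] fun t : ℂ => ‖t‖ ^ K := by
  rcases Nat.eq_zero_or_pos K with rfl | hK
  · have : Continuous (ρ ∘ fun t : ℂ => p0 + t • v) := hρ.continuous.comp (by fun_prop)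
    simpa using (this.tendsto (0 : ℂ)).isBigO_one ℝ
  obtain ⟨d', rfl⟩ : ∃ d', K = d' + 1 := ⟨K - 1, by omega⟩
  obtain ⟨C, hC, hT⟩ := exists_taylor_bound hρ p0 d'
  refine Asymptotics.IsBigO.of_bound (C * ‖v‖ ^ (d' + 1)) ?_
  have hlim : Tendsto (fun t : ℂ => ‖t • v‖) (𝓝 0) (𝓝 0) := by
    have : Continuous fun t : ℂ => ‖t • v‖ := by fun_prop
    simpa using this.tendsto 0
  filter_upwards [hlim.eventually (eventually_le_nhds one_pos)] with t ht
  have h1 := hT p0 (Metric.mem_closedBall_self zero_le_one) (t • v) ht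
  rw [Finset.sum_eq_zero (fun k hk => h t k (Finset.mem_range.mp hk)), sub_zero, norm_smul,
    mul_pow] at h1
  simp only [Function.comp_apply, norm_pow, norm_norm]
  rw [Real.norm_eq_abs]
  linarith

theorem analyticOrderAt_line {v : Cn d} (hv : v ≠ 0) :
    analyticOrderAt (fun t : ℂ => p0 + t • v - p0) 0 = (1 : ℕ) := by
  have ha : AnalyticAt ℂ (fun t : ℂ => p0 + t • v - p0) 0 := by fun_prop
  rw [ha.analyticOrderAt_eq_natCast]
  exact ⟨fun _ => v, analyticAt_const, hv, by simp⟩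

/-- The parametrised line is itself an admissible curve, of order 1 at 0. -/
theorem natCast_le_dAngeloType (hρ : ContDiff ℝ ∞ ρ) {K : ℕ} {v : Cn d} (hv : v ≠ 0)
    (h : LineContact ρ p0 K v) : (K : ℝ≥0∞) ≤ dAngeloType ρ p0 := by
  have ho := analyticOrderAt_line (p0 := p0) hv
  unfold dAngeloType
  refine le_trans ?_ (le_iSup₂_of_le (fun t : ℂ => p0 + t • v) (by fun_prop)
    (le_iSup₂_of_le (by simp) (by rw [ho]; simp) le_rfl))
  rw [ho]
  have : ((K : ℕ∞)) ≤ vanishingOrder (ρ ∘ fun t : ℂ => p0 + t • v) :=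
    le_iSup₂_of_le K (isBigO_of_lineContact hρ h) le_rfl
  have h2 : ((K : ℕ∞) : ℝ≥0∞) ≤ ((vanishingOrder (ρ ∘ fun t : ℂ => p0 + t • v) : ℕ∞) : ℝ≥0∞) :=
    ENat.toENNReal_le.mpr this
  simpa using h2

/-- A curve p0 + t^k g(t) with quotient above L satisfies ρ ∘ γ = O(|t|^(Lk+1)), and then the line
in the direction g(0) would have contact L + 1. -/
theorem dAngeloType_le (hρ : ContDiff ℝ ∞ ρ) (hD : D = {z | ρ z < 0})
    (hconv : Convex ℝ D) (hp0 : p0 ∈ frontier D) (hreg : fderiv ℝ ρ p0 ≠ 0) {L : ℕ} (hL : 1 ≤ L)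
    (hmax : ∀ v : Cn d, v ≠ 0 → ¬ LineContact ρ p0 (L + 1) v) :
    dAngeloType ρ p0 ≤ L := by
  unfold dAngeloType
  refine iSup₂_le fun γ hγ => iSup₂_le fun hγ0 hord => ?_
  obtain ⟨k, hk⟩ := ENat.ne_top_iff_exists.mp hord
  have hγ' : AnalyticAt ℂ (fun t => γ t - p0) 0 := hγ.sub analyticAt_const
  obtain ⟨g, hg, hg0, hgγ⟩ := hγ'.analyticOrderAt_eq_natCast.mp hk.symm
  have hk1 : 1 ≤ k := by
    by_contra hlt
    have h0 : k = 0 := by omega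
    have := hgγ.self_of_nhds
    simp [hγ0, h0] at this
    exact hg0 this.symm
  rw [← hk]
  refine ENNReal.div_le_of_le_mul ?_
  have hle : vanishingOrder (ρ ∘ γ) ≤ ((L * k : ℕ) : ℕ∞) := by
    refine iSup₂_le fun M hM => ?_
    by_contra hlt
    have hlt : L * k + 1 ≤ M := by
      have : L * k < M := by exact_mod_cast not_le.mp hlt
      omega
    refine hmax (g 0) hg0 (lineContact_of_curve (γ := γ) hρ hD hconv hp0 hreg hk1 hL hg ?_ ?_)
    · filter_upwards [hgγ] with t ht
      rw [sub_zero] at ht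
      rw [← ht]; abel
    · refine hM.trans (Asymptotics.IsBigO.of_bound 1 ?_)
      have h1 : ∀ᶠ t : ℂ in 𝓝 0, ‖t‖ < 1 := by
        have := continuous_norm.tendsto (0 : ℂ)
        rw [norm_zero] at this
        exact this.eventually (eventually_lt_nhds one_pos)
      filter_upwards [h1] with t ht
      simp only [norm_pow, norm_norm, one_mul]
      exact pow_le_pow_of_le_one (norm_nonneg _) ht.le hlt
  have := ENat.toENNReal_le.mpr hle
  refine this.trans (le_of_eq ?_)
  simp

/-- The 1-type of a convex hypersurface at a point of finite type is attained by a complex line. -/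
theorem exists_lineType (hρ : ContDiff ℝ ∞ ρ) (hD : D = {z | ρ z < 0})
    (hconv : Convex ℝ D) (hp0 : p0 ∈ frontier D) (hreg : fderiv ℝ ρ p0 ≠ 0)
    (hfin : dAngeloType ρ p0 < ⊤) :
    ∃ L : ℕ, 1 ≤ L ∧ dAngeloType ρ p0 = L ∧ (∃ v : Cn d, v ≠ 0 ∧ LineContact ρ p0 L v) ∧
      ∀ v : Cn d, v ≠ 0 → ¬ LineContact ρ p0 (L + 1) v := by
  classical
  have h0 := defining_eq_zero hρ hD hp0
  obtain ⟨B, hB⟩ := ENNReal.exists_nat_gt hfin.ne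
  let S : ℕ → Prop := fun K => ∃ v : Cn d, v ≠ 0 ∧ LineContact ρ p0 K v
  have hSB : ∀ K, S K → K ≤ B := by
    rintro K ⟨v, hv, hK⟩
    have := (natCast_le_dAngeloType hρ hv hK).trans hB.le
    exact_mod_cast this
  have hS1 : S 1 := by
    obtain ⟨η, hη⟩ := exists_transversal hreg
    refine ⟨η, by rintro rfl; simp at hη, fun θ k hk => ?_⟩
    have : k = 0 := by omega
    rw [this, taylorTerm_zero, h0]
  have hmax := Nat.findGreatest_spec (P := S) (hSB 1 hS1) hS1
  have hge : 1 ≤ Nat.findGreatest S B := Nat.le_findGreatest (hSB 1 hS1) hS1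
  have hnot : ∀ v : Cn d, v ≠ 0 → ¬ LineContact ρ p0 (Nat.findGreatest S B + 1) v := by
    intro v hv hc
    have hs : S (Nat.findGreatest S B + 1) := ⟨v, hv, hc⟩
    have := Nat.le_findGreatest (hSB _ hs) hs
    omega
  refine ⟨_, hge, le_antisymm (dAngeloType_le hρ hD hconv hp0 hreg hge hnot) ?_, hmax, hnot⟩
  obtain ⟨v, hv, hc⟩ := hmax
  exact natCast_le_dAngeloType hρ hv hc

end Curves

/-! ### Parity of the type. -/

section Even

variable {n : ℕ} {ρ : Cn (n + 1) → ℝ} {D : Set (Cn (n + 1))} {p0 : Cn (n + 1)}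

theorem complex_smul_eq {d : ℕ} (θ : ℂ) (v : Cn d) :
    θ • v = θ.re • v + θ.im • (Complex.I • v) := by
  rw [← ofReal_smul_Cn, ← ofReal_smul_Cn, smul_smul, ← add_smul, Complex.re_add_im]

theorem real_linear_smul {d : ℕ} (f : Cn d →L[ℝ] ℝ) (θ : ℂ) (v : Cn d) :
    f (θ • v) = (θ * (f v - Complex.I * f (Complex.I • v))).re := by
  rw [complex_smul_eq, map_add, map_smul, map_smul]
  simp

/-- f is the real part of a complex-linear functional, whose kernel is nontrivial in dimension at
least two. -/
theorem exists_complex_tangent (hn : 1 ≤ n) (f : Cn (n + 1) →L[ℝ] ℝ) :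
    ∃ v : Cn (n + 1), v ≠ 0 ∧ ∀ θ : ℂ, f (θ • v) = 0 := by
  let e (i : Fin (n + 1)) : Cn (n + 1) := EuclideanSpace.single i 1
  let l (v : Cn (n + 1)) : ℂ := f v - Complex.I * f (Complex.I • v)
  have hl : ∀ θ v, f (θ • v) = (θ * l v).re := fun θ v => real_linear_smul f θ v
  let i0 : Fin (n + 1) := 0
  let i1 : Fin (n + 1) := Fin.last n
  have hne : i0 ≠ i1 := by
    intro h
    have := congrArg Fin.val h
    simp [i0, i1] at this
    omega
  by_cases h0 : l (e i0) = 0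
  · refine ⟨e i0, ?_, fun θ => by rw [hl, h0]; simp⟩
    intro h
    have := congrArg (fun v : Cn (n + 1) => v i0) h
    simp [e] at this
  · refine ⟨l (e i1) • e i0 - l (e i0) • e i1, ?_, fun θ => ?_⟩
    · intro h
      have := congrArg (fun v : Cn (n + 1) => v i1) h
      simp [e, hne.symm, h0] at this
    · rw [smul_sub, map_sub, smul_smul, smul_smul, hl, hl, ← Complex.sub_re]
      have : θ * l (e i1) * l (e i0) - θ * l (e i0) * l (e i1) = 0 := by ring
      rw [this, Complex.zero_re]

/-- A complex tangent direction exists, so L ≥ 2 and the extremal line is tangent. Convexity makes ρ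
nonnegative on it, while a leading Taylor term of odd degree would change sign. -/
theorem even_lineType (hn : 1 ≤ n) (hρ : ContDiff ℝ ∞ ρ) (hD : D = {z | ρ z < 0})
    (hconv : Convex ℝ D) (hp0 : p0 ∈ frontier D) (hreg : fderiv ℝ ρ p0 ≠ 0) {L : ℕ}
    (hL : 1 ≤ L) (hex : ∃ v, v ≠ 0 ∧ LineContact ρ p0 L v)
    (hmax : ∀ v, v ≠ 0 → ¬ LineContact ρ p0 (L + 1) v) : Even L := by
  have h0 := defining_eq_zero hρ hD hp0
  have hL2 : 2 ≤ L := by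
    by_contra hlt
    have hL1 : L = 1 := by omega
    obtain ⟨v, hv, hT⟩ := exists_complex_tangent hn (fderiv ℝ ρ p0)
    refine hmax v hv fun θ k hk => ?_
    rcases (show k = 0 ∨ k = 1 by omega) with rfl | rfl
    · rw [taylorTerm_zero, h0]
    · rw [taylorTerm_one, hT]
  obtain ⟨v, hv, hc⟩ := hex
  have hnot := hmax v hv
  unfold LineContact at hnot
  push Not at hnot
  obtain ⟨θ, k, hk, hne⟩ := hnot
  have hkL : k = L := by
    by_contra hkL
    exact hne (hc θ k (by omega))
  subst hkL
  by_contra hodd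
  rw [Nat.not_even_iff_odd] at hodd
  obtain ⟨θ', hneg⟩ : ∃ θ' : ℂ, taylorTerm ρ k p0 (θ' • v) < 0 := by
    rcases lt_or_gt_of_ne hne with h | h
    · exact ⟨θ, h⟩
    · refine ⟨-θ, ?_⟩
      have := taylorTerm_smul ρ k p0 (θ • v) (-1)
      rw [neg_one_smul, hodd.neg_one_pow, ← neg_smul] at this
      rw [this]; linarith
  set y := θ' • v with hy
  set a := taylorTerm ρ k p0 y with ha
  obtain ⟨C, hC, hT⟩ := exists_taylor_bound hρ p0 k
  have hnonneg : ∀ t : ℝ, 0 ≤ ρ (p0 + t • y) := by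
    intro t
    refine nonneg_of_tangent hρ hD hconv hp0 hreg ?_
    rw [map_smul, ← taylorTerm_one, hc θ' 1 (by omega), smul_zero]
  have hlim : Tendsto (fun t : ℝ => C * ‖y‖ ^ (k + 1) * t) (𝓝[>] 0) (𝓝 0) := by
    have : Continuous fun t : ℝ => C * ‖y‖ ^ (k + 1) * t := by fun_prop
    simpa using (this.tendsto 0).mono_left nhdsWithin_le_nhds
  have hlim2 : Tendsto (fun t : ℝ => ‖t • y‖) (𝓝[>] 0) (𝓝 0) := by
    have : Continuous fun t : ℝ => ‖t • y‖ := by fun_prop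
    simpa using (this.tendsto 0).mono_left nhdsWithin_le_nhds
  obtain ⟨t, ⟨ht1, ht2⟩, ht0⟩ := ((hlim.eventually (eventually_lt_nhds (neg_pos.mpr hneg))).and
    (hlim2.eventually (eventually_le_nhds one_pos)) |>.and self_mem_nhdsWithin).exists
  have ht0 : 0 < t := ht0
  have h1 := hT p0 (Metric.mem_closedBall_self zero_le_one) (t • y) ht2
  rw [Finset.sum_range_succ, Finset.sum_eq_zero, zero_add, taylorTerm_smul, norm_smul,
    Real.norm_of_nonneg ht0.le] at h1
  · have h2 := (abs_le.mp h1).2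
    have h3 := hnonneg t
    have h4 : C * (t * ‖y‖) ^ (k + 1) = (C * ‖y‖ ^ (k + 1) * t) * t ^ k := by ring
    rw [h4, ← ha] at h2
    have h5 : 0 < t ^ k := by positivity
    nlinarith
  · intro j hj
    rw [taylorTerm_smul, hc θ' j (Finset.mem_range.mp hj), zero_mul]

/-- The 1-type as an even number `2m`, together with the nonvanishing of some Taylor coefficient
of degree at most `2m` along each complex line. -/
theorem exists_type_data (hρ : ContDiff ℝ ∞ ρ) (hD : D = {z | ρ z < 0})
    (hconv : Convex ℝ D) (hp0 : p0 ∈ frontier D) (hreg : fderiv ℝ ρ p0 ≠ 0)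
    (hfin : dAngeloType ρ p0 < ⊤) :
    ∃ m : ℕ, 1 ≤ m ∧ (1 ≤ n → dAngeloType ρ p0 = ((2 * m : ℕ) : ℝ≥0∞)) ∧
      ∀ v : Cn (n + 1), v ≠ 0 → ∃ θ : ℂ, ∃ k, 1 ≤ k ∧ k ≤ 2 * m ∧
        taylorTerm ρ k p0 (θ • v) ≠ 0 := by
  have h0 := defining_eq_zero hρ hD hp0
  obtain ⟨L, hL, htype, hex, hmax⟩ := exists_lineType hρ hD hconv hp0 hreg hfin
  have key : ∀ d, L ≤ d → ∀ v : Cn (n + 1), v ≠ 0 → ∃ θ : ℂ, ∃ k, 1 ≤ k ∧ k ≤ d ∧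
      taylorTerm ρ k p0 (θ • v) ≠ 0 := by
    intro d hd v hv
    have hnot := hmax v hv
    unfold LineContact at hnot
    push Not at hnot
    obtain ⟨θ, k, hk, hne⟩ := hnot
    refine ⟨θ, k, ?_, by omega, hne⟩
    by_contra hk0
    have : k = 0 := by omega
    rw [this, taylorTerm_zero, h0] at hne
    exact hne rfl
  by_cases hn : 1 ≤ n
  · obtain ⟨m, hm⟩ := even_lineType hn hρ hD hconv hp0 hreg hL hex hmax
    have hm2 : L = 2 * m := by omega
    exact ⟨m, by omega, fun _ => by rw [htype, hm2], key _ hm2.le⟩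
  -- In dimension one L need not be even; only an upper bound for the contact order is needed, and
  -- 2L is one.
  · exact ⟨L, hL, fun h => absurd h hn, key _ (by omega)⟩

end Even

/-! ### Convexity bounds for ρ near p. -/

section Bounds

variable {E : Type*} [NormedAddCommGroup E] [NormedSpace ℝ E] {ρ : E → ℝ} {D : Set E} {p0 : E}

/-- Near a boundary point, an explicit outward displacement leaves the domain. -/
theorem exists_exit [ProperSpace E] (hρ : ContDiff ℝ ∞ ρ) (hD : D = {z | ρ z < 0})
    (h0 : ρ p0 = 0) (hreg : fderiv ℝ ρ p0 ≠ 0) :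
    ∃ η : E, fderiv ℝ ρ p0 η = 1 ∧ ∃ δ > 0, ∀ p ∈ Metric.ball p0 δ, ρ p < 0 →
      p + (2 * -ρ p) • η ∉ D ∧ -ρ p < 1 := by
  obtain ⟨η, hη⟩ := exists_transversal hreg
  obtain ⟨δ, hδ, hgrow⟩ := exists_growth hρ hη
  have hc : Continuous fun p => p + (2 * -ρ p) • η := by
    have := hρ.continuous
    fun_prop
  have h1 : ∀ᶠ p in 𝓝 p0, p + (2 * -ρ p) • η ∈ Metric.ball p0 δ := by
    have := hc.tendsto p0
    simp only [h0, neg_zero, mul_zero, zero_smul, add_zero] at this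
    exact this.eventually (Metric.ball_mem_nhds p0 hδ)
  have h2 : ∀ᶠ p in 𝓝 p0, -ρ p < 1 := by
    have : Tendsto (fun p => -ρ p) (𝓝 p0) (𝓝 (-ρ p0)) := hρ.continuous.neg.tendsto p0
    rw [h0, neg_zero] at this
    exact this.eventually (eventually_lt_nhds one_pos)
  obtain ⟨δ', hδ', H⟩ := Metric.eventually_nhds_iff_ball.mp
    ((h1.and h2).and (Metric.ball_mem_nhds p0 hδ))
  refine ⟨η, hη, δ', hδ', fun p hp hneg => ?_⟩
  obtain ⟨⟨h3, h4⟩, h5⟩ := H p hp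
  refine ⟨?_, h4⟩
  have h6 := hgrow p h5 (2 * -ρ p) (by linarith) h3
  rw [hD]
  intro hlt
  have hlt : ρ (p + (2 * -ρ p) • η) < 0 := hlt
  linarith

/-- At points whose reflection through `p` stays in the convex domain, `-ρ` is controlled by its
value at `p`. -/
theorem exists_reflection_bound [ProperSpace E] (hρ : ContDiff ℝ ∞ ρ) (hD : D = {z | ρ z < 0})
    (hbdd : Bornology.IsBounded D) (hconv : Convex ℝ D)
    (h0 : ρ p0 = 0) (hreg : fderiv ℝ ρ p0 ≠ 0) :
    ∃ C > 0, ∃ δ > 0, ∀ p ∈ Metric.ball p0 δ, ρ p < 0 → ∀ z ∈ D, (2 : ℝ) • p - z ∈ D →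
      -ρ z ≤ C * -ρ p := by
  obtain ⟨η, hη, δ, hδ, hexit⟩ := exists_exit hρ hD h0 hreg
  obtain ⟨R, hR⟩ := hbdd.subset_closedBall p0
  obtain ⟨K, hK, hLip⟩ := exists_lipschitz_bound hρ p0 (R + 4 * ‖η‖)
  refine ⟨K * (4 * ‖η‖) + 1, by positivity, δ, hδ, fun p hp hneg z hz hz' => ?_⟩
  obtain ⟨h1, h2⟩ := hexit p hp hneg
  -- The midpoint of this point and 2p - z is p + 2(-ρ p)η, which lies outside D.
  have h3 : z + (4 * -ρ p) • η ∉ D := by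
    intro hmem
    apply h1
    have := hconv hmem hz' (show (0 : ℝ) ≤ 1 / 2 by norm_num) (show (0 : ℝ) ≤ 1 / 2 by norm_num)
      (by norm_num)
    convert this using 1
    module
  have h4 : 0 ≤ ρ (z + (4 * -ρ p) • η) := by
    rw [hD] at h3
    exact not_lt.mp h3
  have hzR := mem_closedBall_iff_norm.mp (hR hz)
  have hnorm : ‖(4 * -ρ p) • η‖ = 4 * -ρ p * ‖η‖ := by
    rw [norm_smul, Real.norm_of_nonneg (by linarith)]
  have hη0 := norm_nonneg η
  have h5 := hLip z (mem_closedBall_iff_norm.mpr (by nlinarith)) (z + (4 * -ρ p) • η)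
    (mem_closedBall_iff_norm.mpr (by
      calc ‖z + (4 * -ρ p) • η - p0‖ = ‖(z - p0) + (4 * -ρ p) • η‖ := by congr 1; abel
        _ ≤ ‖z - p0‖ + ‖(4 * -ρ p) • η‖ := norm_add_le _ _
        _ ≤ R + 4 * ‖η‖ := by rw [hnorm]; nlinarith))
  rw [add_sub_cancel_left, hnorm] at h5
  have h6 := (abs_le.mp h5).2
  nlinarith

end Bounds

/-! ### Radii of discs under finite type. -/

section Discs

variable {d : ℕ} {ρ : Cn d → ℝ} {D : Set (Cn d)} {p0 : Cn d}

/-- Compactness of the unit sphere and joint continuity of the Taylor terms in base point and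
direction; θ and k may depend on v. -/
theorem exists_uniform_taylor_lower (hρ : ContDiff ℝ ∞ ρ) {k0 : ℕ}
    (hne : ∀ v : Cn d, v ≠ 0 → ∃ θ : ℂ, ∃ k, 1 ≤ k ∧ k ≤ k0 ∧ taylorTerm ρ k p0 (θ • v) ≠ 0) :
    ∃ c > 0, ∃ δ > 0, ∀ p ∈ Metric.ball p0 δ, ∀ v ∈ Metric.sphere (0 : Cn d) 1,
      ∃ θ : ℂ, ‖θ‖ = 1 ∧ ∃ k ≤ k0, c ≤ |taylorTerm ρ k p (θ • v)| := by
  refine IsCompact.induction_on (isCompact_sphere (0 : Cn d) 1)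
    (p := fun S => ∃ c > 0, ∃ δ > 0, ∀ p ∈ Metric.ball p0 δ, ∀ v ∈ S,
      ∃ θ : ℂ, ‖θ‖ = 1 ∧ ∃ k ≤ k0, c ≤ |taylorTerm ρ k p (θ • v)|) ?_ ?_ ?_ ?_
  · exact ⟨1, one_pos, 1, one_pos, by simp⟩
  · rintro s t hst ⟨c, hc, δ, hδ, H⟩
    exact ⟨c, hc, δ, hδ, fun p hp v hv => H p hp v (hst hv)⟩
  · rintro s t ⟨c, hc, δ, hδ, H⟩ ⟨c', hc', δ', hδ', H'⟩
    refine ⟨min c c', lt_min hc hc', min δ δ', lt_min hδ hδ', fun p hp v hv => ?_⟩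
    rcases hv with hv | hv
    · obtain ⟨θ, hθ, k, hk, h⟩ := H p (Metric.ball_subset_ball (min_le_left _ _) hp) v hv
      exact ⟨θ, hθ, k, hk, (min_le_left _ _).trans h⟩
    · obtain ⟨θ, hθ, k, hk, h⟩ := H' p (Metric.ball_subset_ball (min_le_right _ _) hp) v hv
      exact ⟨θ, hθ, k, hk, (min_le_right _ _).trans h⟩
  · intro v0 hv0
    have hv0' : v0 ≠ 0 := by
      rintro rfl; simp at hv0
    obtain ⟨θ, k, hk1, hk, hθ⟩ := hne v0 hv0'
    have hθ0 : θ ≠ 0 := by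
      rintro rfl
      have := taylorTerm_smul ρ k p0 v0 0
      rw [zero_pow (by omega), mul_zero, zero_smul] at this
      rw [zero_smul] at hθ
      exact hθ this
    set u : ℂ := θ / ‖θ‖ with hu
    have hθn : (‖θ‖ : ℂ) ≠ 0 := by exact_mod_cast norm_ne_zero_iff.mpr hθ0
    have hu1 : ‖u‖ = 1 := by simp [hu, hθ0]
    have hne' : taylorTerm ρ k p0 (u • v0) ≠ 0 := by
      intro h
      have h1 : θ • v0 = ‖θ‖ • (u • v0) := by
        rw [← ofReal_smul_Cn, smul_smul, hu, mul_div_cancel₀ _ hθn]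
      rw [h1, taylorTerm_smul, h, zero_mul] at hθ
      exact hθ rfl
    have hcont : Continuous fun x : Cn d × Cn d => |taylorTerm ρ k x.1 (u • x.2)| := by
      have h1 : Continuous fun x : Cn d × Cn d => (x.1, u • x.2) := by fun_prop
      exact ((continuous_taylorTerm hρ k).comp h1).abs
    have hpos : 0 < |taylorTerm ρ k p0 (u • v0)| := abs_pos.mpr hne'
    have hev : ∀ᶠ x in 𝓝 (p0, v0), |taylorTerm ρ k p0 (u • v0)| / 2 <
        |taylorTerm ρ k x.1 (u • x.2)| :=
      hcont.continuousAt.eventually (eventually_gt_nhds (half_lt_self hpos))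
    rw [nhds_prod_eq] at hev
    obtain ⟨A, hA, B, hB, H⟩ := Filter.eventually_prod_iff.mp hev
    obtain ⟨δ, hδ, hball⟩ := Metric.mem_nhds_iff.mp hA
    refine ⟨{v | B v}, mem_nhdsWithin_of_mem_nhds hB, _, half_pos hpos, δ, hδ, ?_⟩
    intro p hp v hv
    exact ⟨u, hu1, k, hk, (H (hball hp) hv).le⟩

/-- Upper bound for the radii of discs centred at `p` inside a convex domain of finite type. -/
theorem exists_disc_radius_bound (hρ : ContDiff ℝ ∞ ρ) (hD : D = {z | ρ z < 0})
    (hbdd : Bornology.IsBounded D) (hconv : Convex ℝ D)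
    (h0 : ρ p0 = 0) (hreg : fderiv ℝ ρ p0 ≠ 0) {k0 : ℕ}
    (hne : ∀ v : Cn d, v ≠ 0 → ∃ θ : ℂ, ∃ k, 1 ≤ k ∧ k ≤ k0 ∧ taylorTerm ρ k p0 (θ • v) ≠ 0) :
    ∃ C > 0, ∃ s0 > 0, ∃ δ > 0, ∀ p ∈ Metric.ball p0 δ, ρ p < 0 → ∀ v : Cn d, ‖v‖ = 1 → ∀ s > 0,
      (∀ c : ℂ, ‖c‖ < s → p + c • v ∈ D) → min s s0 ^ k0 ≤ C * -ρ p := by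
  obtain ⟨c, hc, δ1, hδ1, hlow⟩ := exists_uniform_taylor_lower hρ hne
  obtain ⟨C1, hC1, δ2, hδ2, hrefl⟩ := exists_reflection_bound hρ hD hbdd hconv h0 hreg
  obtain ⟨C2, hC2, hT⟩ := exists_taylor_bound hρ p0 k0
  obtain ⟨C3, hC3, hcoef⟩ := exists_coeff_bound k0
  -- Small enough for the Taylor remainder, once multiplied by C3, to be absorbed by half of the
  -- lower bound c.
  set s0 := min 1 (c / (2 * C3 * C2)) with hs0
  have hs0pos : 0 < s0 := by positivity
  refine ⟨2 ^ k0 * (2 * C3 * C1 / c), by positivity, s0, hs0pos, min 1 (min δ1 δ2), by positivity,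
    ?_⟩
  intro p hp hneg v hv s hs hdisc
  have hp1 : p ∈ Metric.closedBall p0 1 :=
    Metric.ball_subset_closedBall (Metric.ball_subset_ball (min_le_left _ _) hp)
  have hp2 : p ∈ Metric.ball p0 δ1 :=
    Metric.ball_subset_ball ((min_le_right _ _).trans (min_le_left _ _)) hp
  have hp3 : p ∈ Metric.ball p0 δ2 :=
    Metric.ball_subset_ball ((min_le_right _ _).trans (min_le_right _ _)) hp
  obtain ⟨θ, hθ, k, hk, hck⟩ := hlow p hp2 v (by simpa using hv)
  set r := min s s0 / 2 with hr
  have hmin : 0 < min s s0 := lt_min hs hs0pos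
  have hr0 : 0 < r := by positivity
  have hrs : r < s := by have := min_le_left s s0; linarith
  have hrs0 : r ≤ s0 := by have := min_le_right s s0; linarith
  have hr1 : r ≤ 1 := hrs0.trans (min_le_left _ _)
  set ε := -ρ p with hε
  have hεpos : 0 < ε := by linarith
  -- The disc is symmetric about p, so the reflection bound gives |ρ| ≤ C1 ε on it.
  have hbound : ∀ t ∈ Icc 0 r, |∑ k ∈ Finset.range (k0 + 1), taylorTerm ρ k p (θ • v) * t ^ k| ≤
      C1 * ε + C2 * r ^ (k0 + 1) := by
    intro t ht
    have hnorm : ‖t • θ • v‖ = t := by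
      rw [norm_smul, norm_smul, hθ, hv, Real.norm_of_nonneg ht.1]; ring
    have h1 := hT p hp1 (t • θ • v) (by rw [hnorm]; exact ht.2.trans hr1)
    simp only [taylorTerm_smul, hnorm] at h1
    have hmem : ∀ c : ℂ, ‖c‖ = t → p + c • v ∈ D := fun c hc =>
      hdisc c (by rw [hc]; exact ht.2.trans_lt hrs)
    have hm1 : p + t • θ • v ∈ D := by
      rw [← ofReal_smul_Cn, smul_smul]
      exact hmem _ (by simp [hθ, abs_of_nonneg ht.1])
    have hm2 : (2 : ℝ) • p - (p + t • θ • v) ∈ D := by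
      have := hmem (-(t * θ)) (by simp [hθ, abs_of_nonneg ht.1])
      convert this using 1
      rw [← ofReal_smul_Cn t, smul_smul, neg_smul, two_smul]
      abel
    have h2 := hrefl p hp3 hneg _ hm1 hm2
    have h3 : ρ (p + t • θ • v) < 0 := by rw [hD] at hm1; exact hm1
    have h4 : C2 * t ^ (k0 + 1) ≤ C2 * r ^ (k0 + 1) := by
      gcongr
      · exact ht.1
      · exact ht.2
    rw [abs_le] at h1 ⊢
    constructor
    · linarith [h1.2]
    · nlinarith [h1.1]
  have h5 := hcoef _ r _ hr0.le hbound k hk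
  have h6 : r ^ k0 ≤ r ^ k := pow_le_pow_of_le_one hr0.le hr1 hk
  have h7 : C3 * C2 * r ≤ c / 2 := by
    calc C3 * C2 * r ≤ C3 * C2 * (c / (2 * C3 * C2)) := by
          gcongr; exact hrs0.trans (min_le_right _ _)
      _ = c / 2 := by field_simp
  have h8 : c * r ^ k0 ≤ |taylorTerm ρ k p (θ • v)| * r ^ k := by gcongr
  have h9 : c / 2 * r ^ k0 ≤ C3 * C1 * ε := by
    have h10 : C3 * (C1 * ε + C2 * r ^ (k0 + 1)) = C3 * C1 * ε + (C3 * C2 * r) * r ^ k0 := by ring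
    have h11 : (C3 * C2 * r) * r ^ k0 ≤ c / 2 * r ^ k0 := by gcongr
    linarith
  have h12 : min s s0 ^ k0 = 2 ^ k0 * r ^ k0 := by
    rw [← mul_pow, hr]; congr 1; ring
  rw [h12, mul_assoc]
  refine mul_le_mul_of_nonneg_left ?_ (by positivity)
  rw [div_mul_eq_mul_div, le_div_iff₀ hc]
  linarith

end Discs

/-! ### Distance to the boundary along complex lines. -/

section Segment

variable {d : ℕ} {D : Set (Cn d)} {p : Cn d}

/-- Otherwise D and the complement of its closure would disconnect the segment. -/
theorem exists_frontier_of_not_mem (hopen : IsOpen D) (hp : p ∈ D) {y : Cn d} (hy : p + y ∉ D) :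
    ∃ t : ℝ, 0 ≤ t ∧ t ≤ 1 ∧ p + t • y ∈ frontier D := by
  by_contra! h
  apply hy
  have hsub : segment ℝ p (p + y) ⊆ D := by
    refine (convex_segment p (p + y)).isPreconnected.subset_left_of_subset_union hopen
      isClosed_closure.isOpen_compl (v := (closure D)ᶜ)
      (disjoint_compl_right_iff_subset.mpr subset_closure) ?_ ⟨p, left_mem_segment ℝ _ _, hp⟩
    intro x hx
    rw [segment_eq_image'] at hx
    obtain ⟨t, ⟨ht0, ht1⟩, rfl⟩ := hx
    simp only [add_sub_cancel_left]
    have := h t ht0 ht1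
    rw [hopen.frontier_eq] at this
    by_contra hx
    simp only [mem_union, mem_compl_iff, not_or, not_not] at hx
    exact this ⟨hx.2, hx.1⟩
  exact hsub (right_mem_segment ℝ _ _)

theorem ball_infDist_subset (hopen : IsOpen D) (hp : p ∈ D) {y : Cn d}
    (hy : ‖y‖ < Metric.infDist p (frontier D)) : p + y ∈ D := by
  by_contra h
  obtain ⟨t, ht0, ht1, ht⟩ := exists_frontier_of_not_mem hopen hp h
  have h1 := Metric.infDist_le_dist_of_mem (x := p) ht
  rw [dist_self_add_right, norm_smul, Real.norm_of_nonneg ht0] at h1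
  have := mul_le_of_le_one_left (norm_nonneg y) ht1
  linarith

theorem disc_lineDist_subset (hopen : IsOpen D) (hp : p ∈ D) {v : Cn d} {c : ℂ}
    (hc : ‖c • v‖ < lineDist D p v) : p + c • v ∈ D := by
  by_contra h
  obtain ⟨t, ht0, ht1, ht⟩ := exists_frontier_of_not_mem hopen hp h
  have hmem : p + t • c • v ∈ frontier D ∩ range fun c : ℂ => p + c • v :=
    ⟨ht, (t : ℂ) * c, by simp only [← ofReal_smul_Cn, smul_smul]⟩
  have h1 : lineDist D p v ≤ dist p (p + t • c • v) := Metric.infDist_le_dist_of_mem hmem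
  rw [dist_self_add_right, norm_smul, Real.norm_of_nonneg ht0] at h1
  have := mul_le_of_le_one_left (norm_nonneg (c • v)) ht1
  linarith

/-- Boundedness makes the line meet the frontier; `Metric.infDist` to an empty set would be 0. -/
theorem le_lineDist (hopen : IsOpen D) (hbdd : Bornology.IsBounded D) (hp : p ∈ D) {v : Cn d}
    (hv : v ≠ 0) (hdisc : ∀ c : ℂ, ‖c‖ < 1 → p + c • v ∈ D) : ‖v‖ ≤ lineDist D p v := by
  have hne : (frontier D ∩ range fun c : ℂ => p + c • v).Nonempty := by
    obtain ⟨R, hR⟩ := hbdd.subset_closedBall p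
    have hvn : 0 < ‖v‖ := norm_pos_iff.mpr hv
    have hout : p + (((|R| + 1) / ‖v‖ : ℝ)) • v ∉ D := by
      intro h
      have h1 := mem_closedBall_iff_norm.mp (hR h)
      rw [add_sub_cancel_left, norm_smul, Real.norm_of_nonneg (by positivity),
        div_mul_cancel₀ _ hvn.ne'] at h1
      linarith [le_abs_self R]
    obtain ⟨t, -, -, ht⟩ := exists_frontier_of_not_mem hopen hp hout
    exact ⟨_, ht, ((t * ((|R| + 1) / ‖v‖) : ℝ) : ℂ), by
      simp only [ofReal_smul_Cn, smul_smul]⟩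
  refine (Metric.le_infDist hne).mpr ?_
  rintro y ⟨hy, c, rfl⟩
  have hc : 1 ≤ ‖c‖ := by
    by_contra! hlt
    have h1 := hdisc c hlt
    rw [hopen.frontier_eq] at hy
    exact hy.2 h1
  simp only [dist_self_add_right, norm_smul]
  exact le_mul_of_one_le_left (norm_nonneg v) hc

end Segment

/-! ### Geometry of McNeal's radii. -/

section McNeal

variable {n : ℕ} {ρ : Cn (n + 1) → ℝ} {D : Set (Cn (n + 1))} {p : Cn (n + 1)}
  {τ : Fin (n + 1) → ℝ} {ζ : Fin (n + 1) → Cn (n + 1)} {U : Cn (n + 1) ≃ₗᵢ[ℂ] Cn (n + 1)}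

theorem shiftedDomain_neg (hD : D = {z | ρ z < 0}) : shiftedDomain ρ p (-ρ p) = D := by
  simp [shiftedDomain, hD]

/-- The unit vectors of McNeal's construction. -/
noncomputable def extremalDir (U : Cn (n + 1) ≃ₗᵢ[ℂ] Cn (n + 1)) (α : Fin (n + 1)) :
    Cn (n + 1) := U.symm (EuclideanSpace.single α 1)

theorem norm_extremalDir (α : Fin (n + 1)) : ‖extremalDir U α‖ = 1 := by
  simp [extremalDir]

theorem zeta_sub (h : IsMcNealSystem ρ p (-ρ p) τ ζ U) (α : Fin (n + 1)) :
    ζ α - p = (τ α : ℂ) • extremalDir U α := by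
  have h1 := h.align α
  apply U.injective
  rw [h1, extremalDir, map_smul, U.apply_symm_apply]
  ext i
  simp

theorem inner_extremalDir (α : Fin (n + 1)) (v : Cn (n + 1)) :
    inner ℂ (extremalDir U α) v = (U v) α := by
  rw [← U.inner_map_map, extremalDir, U.apply_symm_apply]
  simp [EuclideanSpace.inner_single_left]

theorem tau_pos (hD : D = {z | ρ z < 0}) (hopen : IsOpen D) (hp : p ∈ D)
    (h : IsMcNealSystem ρ p (-ρ p) τ ζ U) (α : Fin (n + 1)) : 0 < τ α := by
  rw [← h.dist_eq α, dist_pos]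
  intro he
  have := h.mem_frontier α
  rw [shiftedDomain_neg hD, ← he, hopen.frontier_eq] at this
  exact this.2 hp

/-- Below the last index τ_α is the boundary distance along this very line; the last radius is the
distance to the whole boundary and so serves in every direction. -/
theorem disc_extremalDir (hD : D = {z | ρ z < 0}) (hopen : IsOpen D) (hp : p ∈ D)
    (h : IsMcNealSystem ρ p (-ρ p) τ ζ U) (α : Fin (n + 1)) {c : ℂ} (hc : ‖c‖ < τ α) :
    p + c • extremalDir U α ∈ D := by
  have hτ := tau_pos hD hopen hp h α
  have hnorm : ‖c • extremalDir U α‖ = ‖c‖ := by rw [norm_smul, norm_extremalDir, mul_one]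
  rcases (Fin.le_last α).lt_or_eq with hα | rfl
  · have h1 := h.realises α hα
    rw [shiftedDomain_neg hD] at h1
    have hτC : (τ α : ℂ) ≠ 0 := by exact_mod_cast hτ.ne'
    have e : c • extremalDir U α = (c / τ α) • (ζ α - p) := by
      rw [zeta_sub h, smul_smul, div_mul_cancel₀ _ hτC]
    rw [e]
    refine disc_lineDist_subset hopen hp ?_
    rw [← e, hnorm, h1]; exact hc
  · have h1 := h.last_eq
    rw [shiftedDomain_neg hD] at h1
    exact ball_infDist_subset hopen hp (by rw [hnorm, ← h1]; exact hc)

/-- The ball of radius τ_n about p lies in D and touches ∂D at ζ_n, so its tangent hyperplane there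
supports D: a point of D beyond it, joined to a suitable point of the ball, would put ζ_n in D. -/
theorem re_inner_lt_of_mem (hD : D = {z | ρ z < 0}) (hopen : IsOpen D) (hconv : Convex ℝ D)
    (hp : p ∈ D) (h : IsMcNealSystem ρ p (-ρ p) τ ζ U) {y : Cn (n + 1)} (hy : p + y ∈ D) :
    ((U y) (Fin.last n)).re < τ (Fin.last n) := by
  by_contra! hle
  set u := extremalDir U (Fin.last n) with hu
  set T := τ (Fin.last n) with hT
  have hTpos : 0 < T := tau_pos hD hopen hp h _
  have hζ := h.mem_frontier (Fin.last n)
  rw [shiftedDomain_neg hD] at hζ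
  have hζeq : ζ (Fin.last n) = p + T • u := by
    have := zeta_sub h (Fin.last n)
    rw [ofReal_smul_Cn] at this
    rw [← this]; abel
  -- move the point slightly beyond the supporting hyperplane
  obtain ⟨δ, hδ, hδD⟩ : ∃ δ > 0, p + (y + (δ : ℝ) • u) ∈ D := by
    have hc : Continuous fun δ : ℝ => p + (y + δ • u) := by fun_prop
    have hev : ∀ᶠ δ : ℝ in 𝓝 0, p + (y + δ • u) ∈ D :=
      hc.continuousAt.eventually (hopen.mem_nhds (by simpa using hy))
    obtain ⟨δ, h1, h2⟩ := ((hev.filter_mono nhdsWithin_le_nhds).and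
      (self_mem_nhdsWithin (a := (0 : ℝ)) (s := Ioi 0))).exists
    exact ⟨δ, h2, h1⟩
  set x := y + δ • u with hx
  set w := x - T • u with hw
  have huu : inner ℂ u u = (1 : ℂ) := by
    rw [inner_self_eq_norm_sq_to_K, hu, norm_extremalDir]; simp
  have hre : δ ≤ (inner ℂ u w).re := by
    rw [hw, hx, inner_sub_right, inner_add_right, ← ofReal_smul_Cn, ← ofReal_smul_Cn,
      inner_smul_right, inner_smul_right, huu, hu, inner_extremalDir]
    simp
    linarith
  set Q := ‖w‖ ^ 2 with hQ
  -- This makes ‖T u - s w‖² ≤ T² - 2Tsδ + s²Q < T², while T u is the mean of T u - s w and x with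
  -- weights 1/(1+s) and s/(1+s).
  obtain ⟨s, hs, hsQ⟩ : ∃ s : ℝ, 0 < s ∧ s * Q < 2 * T * δ := by
    refine ⟨T * δ / (Q + 1), by positivity, ?_⟩
    have hQ0 : 0 ≤ Q := by positivity
    rw [div_mul_eq_mul_div, div_lt_iff₀ (by positivity)]
    have : 0 < T * δ := by positivity
    nlinarith
  have hnorm : ‖T • u - s • w‖ < T := by
    have h1 := norm_sub_sq (𝕜 := ℂ) (T • u) (s • w)
    have h2 : RCLike.re (inner ℂ (T • u) (s • w)) = T * s * (inner ℂ u w).re := by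
      rw [← ofReal_smul_Cn, ← ofReal_smul_Cn, inner_smul_left, inner_smul_right]
      simp
      ring
    rw [h2, norm_smul, norm_smul, Real.norm_of_nonneg hTpos.le, Real.norm_of_nonneg hs.le, hu,
      norm_extremalDir, mul_one, mul_pow s, ← hQ] at h1
    have h3 : T * s * δ ≤ T * s * (inner ℂ u w).re := by gcongr
    have h4 : ‖T • u - s • w‖ ^ 2 < T ^ 2 := by
      rw [hu, h1]
      nlinarith
    exact lt_of_pow_lt_pow_left₀ 2 hTpos.le h4
  have hmem : p + (T • u - s • w) ∈ D := by
    have h1 := h.last_eq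
    rw [shiftedDomain_neg hD] at h1
    exact ball_infDist_subset hopen hp (by rw [← h1]; exact hnorm)
  have hζD : ζ (Fin.last n) ∈ D := by
    have hcomb := hconv hmem hδD (a := 1 / (1 + s)) (b := s / (1 + s)) (by positivity)
      (by positivity) (by field_simp)
    convert hcomb using 1
    rw [hζeq]
    have e : x = w + T • u := by rw [hw]; abel
    rw [e]
    have h1s : (1 + s) ≠ 0 := by positivity
    have e1 : (1 / (1 + s)) • (p + (T • u - s • w)) + (s / (1 + s)) • (p + (w + T • u)) =
        ((1 / (1 + s)) + s / (1 + s)) • (p + T • u) +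
          (s / (1 + s) - (1 / (1 + s)) * s) • w := by module
    rw [e1]
    have e2 : (1 / (1 + s)) + s / (1 + s) = 1 := by field_simp
    have e3 : s / (1 + s) - (1 / (1 + s)) * s = 0 := by ring
    rw [e2, e3, one_smul, zero_smul, add_zero]
  rw [hopen.frontier_eq] at hζ
  exact hζ.2 hζD

/-- Complex discs centred at `p` in `D` are controlled by McNeal's radii. -/
theorem disc_coord_bound (hD : D = {z | ρ z < 0}) (hopen : IsOpen D) (hconv : Convex ℝ D)
    (hbdd : Bornology.IsBounded D)
    (hp : p ∈ D) (h : IsMcNealSystem ρ p (-ρ p) τ ζ U) (j : ℕ) (hj : j < n + 1) :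
    ∀ v : Cn (n + 1), (∀ c : ℂ, ‖c‖ < 1 → p + c • v ∈ D) →
      (∀ β : Fin (n + 1), j < β → (U v) β = 0) →
      ∀ α : Fin (n + 1), α ≤ j → ‖(U v) α‖ ≤ 2 ^ j * τ α := by
  -- The highest possibly nonzero coordinate: below the last index v is orthogonal to the earlier
  -- directions, so maximality of τ_j applies; at the last index the supporting hyperplane is used.
  have top : ∀ j (hj : j < n + 1), ∀ v : Cn (n + 1), (∀ c : ℂ, ‖c‖ < 1 → p + c • v ∈ D) →
      (∀ β : Fin (n + 1), j < β → (U v) β = 0) → ‖(U v) ⟨j, hj⟩‖ ≤ τ ⟨j, hj⟩ := by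
    intro j hj v hv hz
    by_cases hjn : j < n
    · by_cases hv0 : v = 0
      · rw [hv0, map_zero]
        simpa using (tau_pos hD hopen hp h ⟨j, hj⟩).le
      · have h1 := (h.isGreatest ⟨j, hj⟩ (by rw [Fin.lt_def]; simpa using hjn)).2
          (show _ ∈ {r : ℝ | _} from ⟨v, hv0, fun β hβ => by
            rw [zeta_sub h, inner_smul_left, inner_extremalDir, hz β hβ, mul_zero], rfl⟩)
        rw [shiftedDomain_neg hD] at h1
        refine le_trans ?_ ((le_lineDist hopen hbdd hp hv0 hv).trans h1)
        rw [← U.norm_map]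
        exact PiLp.norm_apply_le (U v) ⟨j, hj⟩
    · have hjn : (⟨j, hj⟩ : Fin (n + 1)) = Fin.last n := Fin.ext (by simp; omega)
      rw [hjn]
      by_contra! hlt
      set x := (U v) (Fin.last n) with hx
      have hτ := tau_pos hD hopen hp h (Fin.last n)
      have hx0 : 0 < ‖x‖ := hτ.trans hlt
      -- Rotates and shrinks v so that its last coordinate becomes exactly τ_n, on the supporting
      -- hyperplane.
      set c : ℂ := ((τ (Fin.last n) / ‖x‖ ^ 2 : ℝ) : ℂ) * (starRingEnd ℂ) x with hc
      have hcn : ‖c‖ < 1 := by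
        rw [hc, norm_mul, Complex.norm_real, RCLike.norm_conj, Real.norm_of_nonneg (by positivity)]
        have : τ (Fin.last n) / ‖x‖ ^ 2 * ‖x‖ = τ (Fin.last n) / ‖x‖ := by field_simp
        rw [this, div_lt_one hx0]; exact hlt
      have h1 := re_inner_lt_of_mem hD hopen hconv hp h (hv c hcn)
      have h2 : (U (c • v)) (Fin.last n) = (τ (Fin.last n) : ℂ) := by
        rw [map_smul, PiLp.smul_apply, smul_eq_mul, ← hx, hc, mul_assoc, Complex.conj_mul']
        have : (‖x‖ : ℂ) ≠ 0 := by exact_mod_cast hx0.ne'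
        push_cast
        field_simp
      rw [h2, Complex.ofReal_re] at h1
      exact lt_irrefl _ h1
  induction j with
  | zero =>
    intro v hv hz α hα
    have hα0 : α = ⟨0, hj⟩ := Fin.ext (by simpa using hα)
    rw [hα0, pow_zero, one_mul]
    exact top 0 hj v hv hz
  | succ j ih =>
    intro v hv hz α hα
    have hτ := tau_pos hD hopen hp h α
    have htop := top (j + 1) hj v hv hz
    rcases Nat.lt_or_ge j α with hlt | hge
    · have hαj : α = ⟨j + 1, hj⟩ := Fin.ext (by simp; omega)
      rw [hαj] at hτ ⊢
      exact htop.trans (le_mul_of_one_le_left hτ.le (one_le_pow₀ one_le_two))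
    · set x := (U v) ⟨j + 1, hj⟩ with hx
      -- Averaging with the disc along the extremal direction removes the coordinate j + 1 without
      -- leaving D; the factor 1/2 doubles the constant at each step.
      set v' : Cn (n + 1) := (1 / 2 : ℝ) • (v - x • extremalDir U ⟨j + 1, hj⟩) with hv'
      have hcoord : ∀ β, (U v') β = (1 / 2 : ℝ) * ((U v) β - if β = ⟨j + 1, hj⟩ then x else 0) := by
        intro β
        rw [hv', ← ofReal_smul_Cn, map_smul, map_sub, map_smul, extremalDir, U.apply_symm_apply]
        simp
      have hdisc : ∀ c : ℂ, ‖c‖ < 1 → p + c • v' ∈ D := by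
        intro c hc
        have hτj := tau_pos hD hopen hp h ⟨j + 1, hj⟩
        have h1 : p + (-(c * x)) • extremalDir U ⟨j + 1, hj⟩ ∈ D := by
          refine disc_extremalDir hD hopen hp h _ ?_
          rw [norm_neg, norm_mul]
          nlinarith [norm_nonneg c, norm_nonneg x]
        have h2 := hconv (hv c hc) h1 (show (0 : ℝ) ≤ 1 / 2 by norm_num)
          (show (0 : ℝ) ≤ 1 / 2 by norm_num) (by norm_num)
        convert h2 using 1
        rw [hv', ← ofReal_smul_Cn, ← ofReal_smul_Cn, ← ofReal_smul_Cn]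
        push_cast
        module
      have h3 := ih (by omega) v' hdisc (by
        intro β hβ
        rw [hcoord]
        by_cases hβj : β = ⟨j + 1, hj⟩
        · rw [if_pos hβj, hβj, ← hx]; simp
        · rw [if_neg hβj, hz β (lt_of_le_of_ne hβ fun he => hβj (Fin.ext he.symm))]; simp) α hge
      rw [hcoord, if_neg (by intro he; rw [he] at hge; simp at hge), sub_zero, norm_mul] at h3
      have h4 : ‖((1 / 2 : ℝ) : ℂ)‖ = 1 / 2 := by rw [Complex.norm_real]; norm_num
      rw [h4] at h3
      rw [pow_succ]
      linarith

/-- Holomorphic maps of the ball into a convex domain are controlled by discs. -/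
theorem disc_of_holomorphic {d : ℕ} {D : Set (Cn d)} {p : Cn d}
    (hopen : IsOpen D) (hconv : Convex ℝ D) {ψ : Cn d → Cn d}
    (hψ : DifferentiableOn ℂ ψ (Metric.ball 0 1)) (hmaps : MapsTo ψ (Metric.ball 0 1) D)
    (hψ0 : ψ 0 = p) {z : Cn d} (hz : ‖z‖ < 1) (c : ℂ) (hc : ‖c‖ < 1) :
    p + c • ((1 - ‖z‖) / 2) • (ψ z - p) ∈ D := by
  have hp : p ∈ D := by rw [← hψ0]; exact hmaps (Metric.mem_ball_self one_pos)
  by_cases hz0 : z = 0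
  · rw [hz0, hψ0]; simpa using hp
  have hzpos : 0 < ‖z‖ := norm_pos_iff.mpr hz0
  have hzC : (‖z‖ : ℂ) ≠ 0 := by exact_mod_cast hzpos.ne'
  by_contra hout
  obtain ⟨f, hf⟩ := RCLike.geometric_hahn_banach_open_point (𝕜 := ℂ) hconv hopen hout
  set s := (f (c • ((1 - ‖z‖) / 2) • (ψ z - p))).re with hs
  have hf' : ∀ x ∈ D, (f x).re < (f p).re + s := by
    intro x hx
    have := hf x hx
    rw [map_add f, map_add] at this
    exact this
  have hs0 : 0 < s := by linarith [hf' p hp]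
  have hF : ∀ x ∈ D, (f (x - p)).re ≤ s := by
    intro x hx
    rw [map_sub, Complex.sub_re]
    linarith [hf' x hx]
  let line : ℂ → Cn d := fun t => (t / ‖z‖) • z
  have hline : ∀ t ∈ Metric.ball (0 : ℂ) 1, line t ∈ Metric.ball (0 : Cn d) 1 := by
    intro t ht
    rw [mem_ball_zero_iff] at ht ⊢
    simp only [line, norm_smul, norm_div, Complex.norm_real, norm_norm]
    rwa [div_mul_cancel₀ _ hzpos.ne']
  let F : ℂ → ℂ := fun t => f (ψ (line t) - p)
  have hFd : DifferentiableOn ℂ F (Metric.ball 0 1) := by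
    have h1 : DifferentiableOn ℂ line (Metric.ball 0 1) := by
      simp only [line]; fun_prop
    have h2 : DifferentiableOn ℂ (ψ ∘ line) (Metric.ball 0 1) := hψ.comp h1 hline
    exact f.differentiable.comp_differentiableOn (h2.sub_const p)
  -- On the slice through z this reads |F(‖z‖)| ≤ 2s‖z‖/(1 - ‖z‖). The factor (1 - ‖z‖)/2 in the
  -- statement cancels it, leaving s ≤ s‖z‖ < s.
  have hBC := Complex.borelCaratheodory_zero (f := F) (R := 1) (z := (‖z‖ : ℂ)) hs0 hFd
    (fun t ht => hF _ (hmaps (hline t ht))) one_pos (by simpa using hz) (by simp [F, line, hψ0])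
  have hFz : F ‖z‖ = f (ψ z - p) := by simp [F, line, hzC]
  rw [hFz, Complex.norm_real, norm_norm] at hBC
  have h1z : 0 < 1 - ‖z‖ := by linarith
  rw [le_div_iff₀ h1z] at hBC
  have h1 : s ≤ ‖c‖ * ((1 - ‖z‖) / 2 * ‖f (ψ z - p)‖) := by
    refine (Complex.re_le_norm _).trans (le_of_eq ?_)
    rw [← ofReal_smul_Cn, map_smul, map_smul, norm_smul, norm_smul, Complex.norm_real,
      Real.norm_of_nonneg (by positivity)]
  have h2 : (1 - ‖z‖) / 2 * ‖f (ψ z - p)‖ ≤ s * ‖z‖ := by linarith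
  have h3 : ‖c‖ * ((1 - ‖z‖) / 2 * ‖f (ψ z - p)‖) ≤ 1 * (s * ‖z‖) := by gcongr
  nlinarith

/-- The discs of `disc_of_holomorphic` have coordinates at most 2^n τ_α, so dividing by τ_α leaves a
bound free of p, τ and ψ. -/
theorem scaled_holomorphic_bound (hD : D = {z | ρ z < 0}) (hopen : IsOpen D) (hconv : Convex ℝ D)
    (hbdd : Bornology.IsBounded D) (h : IsMcNealSystem ρ p (-ρ p) τ ζ U)
    {ψ : Cn (n + 1) → Cn (n + 1)}
    (hψ : DifferentiableOn ℂ ψ (Metric.ball 0 1)) (hmaps : MapsTo ψ (Metric.ball 0 1) D)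
    (hψ0 : ψ 0 = p) {z : Cn (n + 1)} (hz : ‖z‖ < 1) (α : Fin (n + 1)) :
    ‖scalingMap p τ U (ψ z) α‖ ≤ 2 ^ (n + 1) / (1 - ‖z‖) := by
  have hp : p ∈ D := by rw [← hψ0]; exact hmaps (Metric.mem_ball_self one_pos)
  have hτ := tau_pos hD hopen hp h α
  have h1 := disc_coord_bound hD hopen hconv hbdd hp h n (Nat.lt_succ_self n)
    (((1 - ‖z‖) / 2) • (ψ z - p))
    (fun c hc => disc_of_holomorphic hopen hconv hψ hmaps hψ0 hz c hc)
    (fun β hβ => absurd β.2 (by omega)) α (by omega)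
  have h1z : 0 < 1 - ‖z‖ := by linarith
  rw [← ofReal_smul_Cn, map_smul, PiLp.smul_apply, norm_smul, Complex.norm_real,
    Real.norm_of_nonneg (by positivity)] at h1
  simp only [scalingMap]
  rw [norm_div, Complex.norm_real, Real.norm_of_nonneg hτ.le, div_le_div_iff₀ hτ h1z, pow_succ]
  linarith

end McNeal

/-! ### The volume element: scaling and stability. -/

section Volume

variable {d : ℕ}

/-- The set of values `|det ψ'(0)|⁻²` whose infimum is the Kobayashi-Eisenman volume element. -/
def volumeValues (D : Set (Cn d)) (p : Cn d) : Set ℝ :=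
  {x : ℝ | ∃ ψ : Cn d → Cn d, DifferentiableOn ℂ ψ (Metric.ball 0 1) ∧
    MapsTo ψ (Metric.ball 0 1) D ∧ ψ 0 = p ∧
    (fderiv ℂ ψ 0).det ≠ 0 ∧ x = (‖(fderiv ℂ ψ 0).det‖ ^ 2)⁻¹}

theorem kobayashiVol_eq (D : Set (Cn d)) (p : Cn d) :
    kobayashiVol D p = sInf (volumeValues D p) := rfl

theorem volumeValues_bddBelow (D : Set (Cn d)) (p : Cn d) : BddBelow (volumeValues D p) :=
  ⟨0, by rintro x ⟨ψ, -, -, -, -, rfl⟩; positivity⟩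

/-- The linear part of the inverse scaling map. -/
noncomputable def scalingLin (τ : Fin d → ℝ) (U : Cn d ≃ₗᵢ[ℂ] Cn d) : Cn d →L[ℂ] Cn d :=
  LinearMap.toContinuousLinearMap (U.symm.toLinearEquiv.toLinearMap ∘ₗ
    Matrix.toLin (EuclideanSpace.basisFun (Fin d) ℂ).toBasis
      (EuclideanSpace.basisFun (Fin d) ℂ).toBasis (Matrix.diagonal fun α => (τ α : ℂ)))

theorem scalingMapInv_eq (p : Cn d) (τ : Fin d → ℝ) (U : Cn d ≃ₗᵢ[ℂ] Cn d) (w : Cn d) :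
    scalingMapInv p τ U w = p + scalingLin τ U w := by
  have h : Matrix.toLin (EuclideanSpace.basisFun (Fin d) ℂ).toBasis
      (EuclideanSpace.basisFun (Fin d) ℂ).toBasis (Matrix.diagonal fun α => (τ α : ℂ)) w =
      WithLp.toLp 2 fun α => (τ α : ℂ) * w α := by
    ext α
    rw [Matrix.toLin_apply]
    simp [Matrix.mulVec_diagonal, Pi.single_apply]
  simp only [scalingMapInv, scalingLin, LinearMap.coe_toContinuousLinearMap', LinearMap.comp_apply,
    h]
  rfl

theorem norm_det_scalingLin (τ : Fin d → ℝ) (U : Cn d ≃ₗᵢ[ℂ] Cn d) (hτ : ∀ α, 0 < τ α) :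
    ‖(scalingLin τ U).det‖ = ∏ α, τ α := by
  have h1 : ‖LinearMap.det U.symm.toLinearEquiv.toLinearMap‖ = 1 := by
    have := U.symm.toLinearIsometry.normDet_eq_one
    rwa [LinearMap.normDet_eq_norm_det] at this
  rw [scalingLin, ContinuousLinearMap.det, LinearMap.coe_toContinuousLinearMap, LinearMap.det_comp,
    norm_mul, h1, one_mul, LinearMap.det_toLin, Matrix.det_diagonal, norm_prod]
  exact Finset.prod_congr rfl fun α _ => by simp [abs_of_pos (hτ α)]

theorem det_comp_clm (A B : Cn d →L[ℂ] Cn d) : (A ∘L B).det = A.det * B.det :=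
  LinearMap.det_comp A.toLinearMap B.toLinearMap

/-- Composition with the affine scaling matches the competitors of the two domains and multiplies
Jacobians by a number of modulus ∏ τ_α, the unitary part having determinant of modulus one. -/
theorem kobayashiVol_mul_prod (D : Set (Cn d)) (p : Cn d) (τ : Fin d → ℝ)
    (U : Cn d ≃ₗᵢ[ℂ] Cn d) (hτ : ∀ α, 0 < τ α) :
    kobayashiVol D p * ∏ α, τ α ^ 2 = kobayashiVol (scalingMapInv p τ U ⁻¹' D) 0 := by
  set A := scalingLin τ U with hA
  set P := ∏ α, τ α ^ 2 with hP
  have hPpos : 0 < P := Finset.prod_pos fun α _ => pow_pos (hτ α) 2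
  have hdet : ‖A.det‖ ^ 2 = P := by
    rw [hA, norm_det_scalingLin τ U hτ, hP, Finset.prod_pow]
  have hderiv : ∀ φ : Cn d → Cn d, DifferentiableOn ℂ φ (Metric.ball 0 1) →
      fderiv ℂ (fun z => p + A (φ z)) 0 = A ∘L fderiv ℂ φ 0 := by
    intro φ hφ
    have h1 : DifferentiableAt ℂ φ 0 :=
      hφ.differentiableAt (Metric.ball_mem_nhds 0 one_pos)
    exact ((A.hasFDerivAt.comp 0 h1.hasFDerivAt).const_add p).fderiv
  have hset : volumeValues D p = P⁻¹ • volumeValues (scalingMapInv p τ U ⁻¹' D) 0 := by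
    ext x
    rw [Set.mem_smul_set]
    constructor
    · rintro ⟨ψ, hψ, hmaps, hψ0, hne, rfl⟩
      let φ : Cn d → Cn d := fun z => scalingMap p τ U (ψ z)
      have hφψ : ψ = fun z => p + A (φ z) := by
        funext z
        rw [← scalingMapInv_eq]
        exact (scalingMapInv_scalingMap p τ U (fun α => (hτ α).ne') _).symm
      have hφ : DifferentiableOn ℂ φ (Metric.ball 0 1) := by
        rw [differentiableOn_euclidean]
        intro α
        have h1 : DifferentiableOn ℂ (fun z => U (ψ z - p)) (Metric.ball 0 1) :=
          U.toContinuousLinearEquiv.differentiable.comp_differentiableOn (hψ.sub_const p)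
        have h2 := differentiableOn_euclidean.mp h1 α
        simpa only [φ, scalingMap, div_eq_mul_inv] using h2.mul_const ((τ α : ℂ)⁻¹)
      rw [hφψ, hderiv φ hφ, det_comp_clm] at hne
      refine ⟨_, ⟨φ, hφ, ?_, ?_, right_ne_zero_of_mul hne, rfl⟩, ?_⟩
      · intro z hz
        show scalingMapInv p τ U (scalingMap p τ U (ψ z)) ∈ D
        rw [scalingMapInv_scalingMap p τ U (fun α => (hτ α).ne')]
        exact hmaps hz
      · simp only [φ, hψ0]
        ext α; simp [scalingMap]
      · rw [smul_eq_mul]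
        conv_rhs => rw [hφψ, hderiv φ hφ, det_comp_clm, norm_mul, mul_pow, mul_inv]
        rw [← hdet]
    · rintro ⟨y, ⟨φ, hφ, hmaps, hφ0, hne, rfl⟩, rfl⟩
      have hAne : A.det ≠ 0 := by
        intro h0
        rw [h0] at hdet
        simp at hdet
        exact hPpos.ne hdet
      have hd : (fderiv ℂ (fun z => p + A (φ z)) 0).det = A.det * (fderiv ℂ φ 0).det := by
        rw [hderiv φ hφ, det_comp_clm]
      refine ⟨fun z => p + A (φ z), (A.differentiable.comp_differentiableOn hφ).const_add p,
        ?_, by simp [hφ0], by rw [hd]; exact mul_ne_zero hAne hne, ?_⟩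
      · intro z hz
        have := hmaps hz
        rw [mem_preimage, scalingMapInv_eq] at this
        exact this
      · rw [hd, norm_mul, mul_pow, hdet, mul_inv, smul_eq_mul]
  rw [kobayashiVol_eq, kobayashiVol_eq, hset, Real.sInf_smul_of_nonneg (by positivity), smul_eq_mul]
  field_simp

/-- The competitor is z ↦ a ψ(r z), with Jacobian multiplied by (a r)^d. Shrinking the source and
the image is how competitors pass between neighbouring domains. -/
theorem volumeValues_rescale {Ω' : Set (Cn d)} {a r : ℝ} (ha : 0 < a) (hr : 0 < r)
    (hr1 : r ≤ 1) {ψ : Cn d → Cn d} (hψ : DifferentiableOn ℂ ψ (Metric.ball 0 1))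
    (hψ0 : ψ 0 = 0) (hne : (fderiv ℂ ψ 0).det ≠ 0)
    (hmaps : ∀ z : Cn d, ‖z‖ < r → a • ψ z ∈ Ω') :
    (‖(fderiv ℂ ψ 0).det‖ ^ 2)⁻¹ / ((a * r) ^ d) ^ 2 ∈ volumeValues Ω' 0 := by
  have hmem : ∀ z ∈ Metric.ball (0 : Cn d) 1, (r : ℂ) • z ∈ Metric.ball (0 : Cn d) r := by
    intro z hz
    rw [mem_ball_zero_iff] at hz ⊢
    rw [norm_smul, Complex.norm_real, Real.norm_of_nonneg hr.le]
    nlinarith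
  let φ : Cn d → Cn d := fun z => (a : ℂ) • ψ ((r : ℂ) • z)
  have hlin : DifferentiableOn ℂ (fun z : Cn d => (r : ℂ) • z) (Metric.ball 0 1) := by fun_prop
  have hφ : DifferentiableOn ℂ φ (Metric.ball 0 1) :=
    (hψ.comp hlin fun z hz => Metric.ball_subset_ball hr1 (hmem z hz)).const_smul (a : ℂ)
  have hd : fderiv ℂ φ 0 = ((a * r : ℝ) : ℂ) • fderiv ℂ ψ 0 := by
    have h1 : HasFDerivAt ψ (fderiv ℂ ψ 0) ((r : ℂ) • (0 : Cn d)) := by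
      rw [smul_zero]
      exact (hψ.differentiableAt (Metric.ball_mem_nhds 0 one_pos)).hasFDerivAt
    have h2 : HasFDerivAt (fun z : Cn d => (r : ℂ) • z)
        ((r : ℂ) • ContinuousLinearMap.id ℂ (Cn d)) 0 :=
    ((r : ℂ) • ContinuousLinearMap.id ℂ (Cn d)).hasFDerivAt
    have h3 := ((h1.comp 0 h2).const_smul (a : ℂ)).fderiv
    refine h3.trans ?_
    ext v i
    simp [mul_assoc]
  have hdet : (fderiv ℂ φ 0).det = ((a * r : ℝ) : ℂ) ^ d * (fderiv ℂ ψ 0).det := by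
    rw [hd, ContinuousLinearMap.det, ContinuousLinearMap.toLinearMap_smul, LinearMap.det_smul,
      finrank_euclideanSpace_fin]
  have har : 0 < a * r := mul_pos ha hr
  refine ⟨φ, hφ, ?_, by simp [φ, hψ0], ?_, ?_⟩
  · intro z hz
    simp only [φ, ofReal_smul_Cn a]
    exact hmaps _ (mem_ball_zero_iff.mp (hmem z hz))
  · rw [hdet]
    refine mul_ne_zero (pow_ne_zero _ ?_) hne
    exact_mod_cast har.ne'
  · rw [hdet, norm_mul, norm_pow, Complex.norm_real, Real.norm_of_nonneg har.le,
      mul_pow ((a * r) ^ d), mul_inv,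
      div_eq_mul_inv, mul_comm]

theorem volumeValues_nonempty {Ω : Set (Cn d)} (hΩ : Ω ∈ 𝓝 (0 : Cn d)) :
    (volumeValues Ω 0).Nonempty := by
  obtain ⟨δ, hδ, hball⟩ := Metric.mem_nhds_iff.mp hΩ
  refine ⟨_, volumeValues_rescale (ψ := id) hδ one_pos le_rfl differentiableOn_id rfl
    ?_ ?_⟩
  · rw [fderiv_id]
    simp [ContinuousLinearMap.det]
  · intro z hz
    apply hball
    rw [mem_ball_zero_iff, norm_smul, Real.norm_of_nonneg hδ.le]
    simp only [id]
    nlinarith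

/-- Stability of the Kobayashi-Eisenman volume element under locally uniform convergence of
defining functions, for a convex limit and uniformly controlled holomorphic maps. -/
theorem tendsto_kobayashiVol {f : ℕ → Cn d → ℝ} {g : Cn d → ℝ} (hg : ConvexOn ℝ univ g)
    (hgc : Continuous g) (hg0 : g 0 = -1)
    (hfg : ∀ K : Set (Cn d), IsCompact K → TendstoUniformlyOn f g atTop K)
    (hbound : ∀ r : ℝ, 0 < r → r < 1 → ∃ R : ℝ, ∀ j, ∀ ψ : Cn d → Cn d,
      DifferentiableOn ℂ ψ (Metric.ball 0 1) → MapsTo ψ (Metric.ball 0 1) {z | f j z < 0} →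
      ψ 0 = 0 → ∀ z, ‖z‖ < r → ‖ψ z‖ ≤ R) :
    Tendsto (fun j => kobayashiVol {z | f j z < 0} 0) atTop (𝓝 (kobayashiVol {z | g z < 0} 0)) := by
  set M := {z | g z < 0} with hM
  have hMopen : M ∈ 𝓝 (0 : Cn d) :=
    (isOpen_lt hgc continuous_const).mem_nhds (show g 0 < 0 by rw [hg0]; norm_num)
  have upper : ∀ x ∈ volumeValues M 0, ∀ r : ℝ, 0 < r → r < 1 →
      ∀ᶠ j in atTop, x / (r ^ d) ^ 2 ∈ volumeValues {z | f j z < 0} 0 := by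
    rintro x ⟨ψ, hψ, hmaps, hψ0, hne, rfl⟩ r hr hr1
    have hsub : Metric.closedBall (0 : Cn d) r ⊆ Metric.ball 0 1 :=
      Metric.closedBall_subset_ball hr1
    -- On this compact image g has a negative maximum, so f j is negative there for large j.
    have hcomp : IsCompact (ψ '' Metric.closedBall 0 r) :=
      (isCompact_closedBall 0 r).image_of_continuousOn (hψ.continuousOn.mono hsub)
    obtain ⟨w, ⟨z, hz, rfl⟩, hmax⟩ := hcomp.exists_isMaxOn
      ⟨ψ 0, 0, Metric.mem_closedBall_self hr.le, rfl⟩ hgc.continuousOn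
    have hneg : g (ψ z) < 0 := hmaps (hsub hz)
    have hunif := Metric.tendstoUniformlyOn_iff.mp (hfg _ hcomp) (-g (ψ z)) (neg_pos.mpr hneg)
    filter_upwards [hunif] with j hj
    have := volumeValues_rescale (Ω' := {z | f j z < 0}) one_pos hr hr1.le hψ hψ0 hne ?_
    · rwa [one_mul] at this
    · intro y hy
      have hyK : ψ y ∈ ψ '' Metric.closedBall 0 r :=
        ⟨y, mem_closedBall_zero_iff.mpr hy.le, rfl⟩
      have h1 := hj _ hyK
      have h2 : g (ψ y) ≤ g (ψ z) := hmax hyK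
      rw [Real.dist_eq, abs_lt] at h1
      rw [one_smul]
      show f j (ψ y) < 0
      linarith [h1.1]
  have lower : ∀ t : ℝ, 0 < t → t < 1 → ∀ᶠ j in atTop, ∀ x ∈ volumeValues {z | f j z < 0} 0,
      x / ((t * t) ^ d) ^ 2 ∈ volumeValues M 0 := by
    intro t ht ht1
    obtain ⟨R, hR⟩ := hbound t ht ht1
    have hs : 0 < 1 / t - 1 := by
      have : 1 < 1 / t := by rw [lt_div_iff₀ ht]; linarith
      linarith
    have hunif := Metric.tendstoUniformlyOn_iff.mp
      (hfg _ (isCompact_closedBall (0 : Cn d) R)) _ hs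
    filter_upwards [hunif] with j hj
    rintro x ⟨ψ, hψ, hmaps, hψ0, hne, rfl⟩
    refine volumeValues_rescale ht ht ht1.le hψ hψ0 hne ?_
    intro z hz
    have h1 := hj (ψ z) (mem_closedBall_zero_iff.mpr (hR j ψ hψ hmaps hψ0 z hz))
    have h2 : f j (ψ z) < 0 := hmaps (mem_ball_zero_iff.mpr (hz.trans ht1))
    rw [Real.dist_eq, abs_lt] at h1
    -- From g(ψ z) < 1/t - 1 and g(0) = -1, convexity yields g(t ψ z) < t(1/t - 1) - (1 - t) = 0.
    have h3 := hg.2 (mem_univ (ψ z)) (mem_univ 0) ht.le (sub_nonneg.mpr ht1.le) (by ring)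
    rw [smul_zero, add_zero, hg0, smul_eq_mul, smul_eq_mul] at h3
    have h4 : t * g (ψ z) < t * (1 / t - 1) := by
      refine mul_lt_mul_of_pos_left ?_ ht
      linarith [h1.2]
    have h5 : t * (1 / t - 1) = 1 - t := by field_simp
    show g (t • ψ z) < 0
    linarith
  have hlim : ∀ e : ℕ, Tendsto (fun t : ℝ => t ^ e) (𝓝[<] 1) (𝓝 1) := by
    intro e
    have : Continuous fun t : ℝ => t ^ e := by fun_prop
    simpa using (this.tendsto 1).mono_left nhdsWithin_le_nhds
  have hIoo : ∀ᶠ t : ℝ in 𝓝[<] 1, 0 < t ∧ t < 1 := by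
    filter_upwards [Ioo_mem_nhdsLT (show (0 : ℝ) < 1 from one_pos)] with t ht using ht
  rw [tendsto_order]
  constructor
  · intro a ha
    have h1 : Tendsto (fun t : ℝ => ((t * t) ^ d) ^ 2 * kobayashiVol M 0) (𝓝[<] 1)
        (𝓝 (kobayashiVol M 0)) := by
      have : Tendsto (fun t : ℝ => t ^ (2 * d * 2) * kobayashiVol M 0) (𝓝[<] 1)
          (𝓝 (1 * kobayashiVol M 0)) := (hlim (2 * d * 2)).mul_const _
      rw [one_mul] at this
      refine this.congr fun t => ?_
      rw [← pow_two, ← pow_mul, ← pow_mul, mul_assoc]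
    obtain ⟨t, h2, ht0, ht1⟩ := ((h1.eventually (eventually_gt_nhds ha)).and hIoo).exists
    obtain ⟨x, hx⟩ := volumeValues_nonempty hMopen
    filter_upwards [lower t ht0 ht1, upper x hx t ht0 ht1] with j hj hne
    -- A competitor must be exhibited, since the infimum of the empty set is 0 by convention.
    refine h2.trans_le (le_csInf ⟨_, hne⟩ fun y hy => ?_)
    have h3 : kobayashiVol M 0 ≤ y / ((t * t) ^ d) ^ 2 :=
      csInf_le (volumeValues_bddBelow M 0) (hj y hy)
    rwa [le_div_iff₀ (by positivity), mul_comm] at h3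
  · intro b hb
    obtain ⟨x, hx, hxb⟩ := exists_lt_of_csInf_lt (volumeValues_nonempty hMopen) hb
    have h1 : Tendsto (fun t : ℝ => (t ^ d) ^ 2 * b) (𝓝[<] 1) (𝓝 b) := by
      have : Tendsto (fun t : ℝ => t ^ (d * 2) * b) (𝓝[<] 1) (𝓝 (1 * b)) :=
        (hlim (d * 2)).mul_const _
      rw [one_mul] at this
      exact this.congr fun t => by rw [← pow_mul]
    obtain ⟨t, h2, ht0, ht1⟩ := ((h1.eventually (eventually_gt_nhds hxb)).and hIoo).exists
    filter_upwards [upper x hx t ht0 ht1] with j hj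
    refine (csInf_le (volumeValues_bddBelow _ 0) hj).trans_lt ?_
    rw [div_lt_iff₀ (by positivity), mul_comm]
    exact h2

end Volume

/-! ### Compactness in finite-dimensional function spaces. -/

/-- In a finite-dimensional space of continuous functions, a sequence bounded pointwise on a set
of uniqueness has a subsequence converging uniformly on compact sets. -/
theorem exists_subseq_tendsto_of_finiteDimensional {X : Type*} [TopologicalSpace X]
    (W : Submodule ℝ (X → ℝ)) [FiniteDimensional ℝ W] (hcont : ∀ f ∈ W, Continuous f) (B : Set X)
    (huniq : ∀ f ∈ W, (∀ x ∈ B, f x = 0) → f = 0) (f : ℕ → X → ℝ) (hf : ∀ j, f j ∈ W)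
    (hbdd : ∀ x ∈ B, ∃ C : ℝ, ∀ᶠ j in atTop, |f j x| ≤ C) :
    ∃ φ : ℕ → ℕ, StrictMono φ ∧ ∃ g ∈ W, ∀ K : Set X, IsCompact K →
      TendstoUniformlyOn (fun j => f (φ j)) g atTop K := by
  let ev : X → Module.Dual ℝ W := fun x => (LinearMap.proj x).comp W.subtype
  -- Uniqueness on B says that evaluations at B have no common kernel, so they span the dual; bounds
  -- on B then bound every coordinate.
  have hspan : Submodule.span ℝ (ev '' B) = ⊤ := by
    have hbot : (Submodule.span ℝ (ev '' B)).dualCoannihilator = ⊥ := by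
      rw [eq_bot_iff]
      intro w hw
      rw [Submodule.mem_dualCoannihilator] at hw
      rw [Submodule.mem_bot]
      apply Subtype.ext
      exact huniq w.1 w.2 fun x hx => hw (ev x) (Submodule.subset_span ⟨x, hx, rfl⟩)
    have := Subspace.dualCoannihilator_dualAnnihilator_eq (W := Submodule.span ℝ (ev '' B))
    rw [← this, hbot, Submodule.dualAnnihilator_bot]
  let F : ℕ → W := fun j => ⟨f j, hf j⟩
  have hall : ∀ l : Module.Dual ℝ W, ∃ C : ℝ, ∀ᶠ j in atTop, |l (F j)| ≤ C := by
    intro l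
    have hl : l ∈ Submodule.span ℝ (ev '' B) := by rw [hspan]; trivial
    induction hl using Submodule.span_induction with
    | mem l hl =>
      obtain ⟨x, hx, rfl⟩ := hl
      exact hbdd x hx
    | zero => exact ⟨0, by simp⟩
    | add l l' _ _ h h' =>
      obtain ⟨C, hC⟩ := h
      obtain ⟨C', hC'⟩ := h'
      refine ⟨C + C', ?_⟩
      filter_upwards [hC, hC'] with j h1 h2
      exact (abs_add_le _ _).trans (add_le_add h1 h2)
    | smul a l _ h =>
      obtain ⟨C, hC⟩ := h
      refine ⟨|a| * C, ?_⟩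
      filter_upwards [hC] with j h1
      rw [LinearMap.smul_apply, smul_eq_mul, abs_mul]
      exact mul_le_mul_of_nonneg_left h1 (abs_nonneg _)
  let b := Module.finBasis ℝ W
  choose C hC using fun i => hall (b.coord i)
  let c : ℕ → Fin (Module.finrank ℝ W) → ℝ := fun j i => b.coord i (F j)
  have hev : ∀ᶠ j in atTop, c j ∈ Metric.closedBall (0 : Fin (Module.finrank ℝ W) → ℝ)
      (∑ i, |C i|) := by
    filter_upwards [eventually_all.mpr hC] with j hj
    rw [mem_closedBall_zero_iff, pi_norm_le_iff_of_nonneg (by positivity)]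
    intro i
    exact ((hj i).trans (le_abs_self _)).trans
      (Finset.single_le_sum (f := fun i => |C i|) (fun _ _ => abs_nonneg _) (Finset.mem_univ i))
  obtain ⟨a, -, φ, hφ, hlim⟩ :=
    tendsto_subseq_of_frequently_bounded Metric.isBounded_closedBall hev.frequently
  have hexp : ∀ (w : W) (x : X), w.1 x = ∑ i, b.coord i w * (b i).1 x := by
    intro w x
    have h1 := congrArg (fun v : W => v.1 x) (b.sum_repr w)
    simp only [Submodule.coe_sum, Finset.sum_apply, Submodule.coe_smul, Pi.smul_apply,
      smul_eq_mul] at h1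
    exact h1.symm
  refine ⟨φ, hφ, fun x => ∑ i, a i * (b i).1 x, ?_, ?_⟩
  · have : (fun x => ∑ i, a i * (b i).1 x) = ((∑ i, a i • b i : W) : X → ℝ) := by
      funext x
      simp [Finset.sum_apply]
    rw [this]
    exact Submodule.coe_mem _
  · intro K hK
    have hM : ∀ i, ∃ M : ℝ, ∀ x ∈ K, |(b i).1 x| ≤ M := fun i =>
      hK.exists_bound_of_continuousOn (hcont _ (b i).2).continuousOn
    choose M hM using hM
    have hzero : Tendsto (fun j => ∑ i, |c (φ j) i - a i| * |M i|) atTop (𝓝 0) := by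
      have h1 : ∀ i, Tendsto (fun j => |c (φ j) i - a i| * |M i|) atTop (𝓝 0) := by
        intro i
        have h2 : Tendsto (fun j => c (φ j) i) atTop (𝓝 (a i)) := (tendsto_pi_nhds.mp hlim) i
        have h3 := ((h2.sub_const (a i)).abs).mul_const |M i|
        simpa using h3
      simpa using tendsto_finsetSum Finset.univ fun i _ => h1 i
    rw [Metric.tendstoUniformlyOn_iff]
    intro δ hδ
    filter_upwards [hzero.eventually (eventually_lt_nhds hδ)] with j hj x hx
    refine lt_of_le_of_lt ?_ hj
    have h4 : f (φ j) x = ∑ i, c (φ j) i * (b i).1 x := hexp (F (φ j)) x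
    rw [dist_comm, Real.dist_eq, h4, ← Finset.sum_sub_distrib]
    refine (Finset.abs_sum_le_sum_abs _ _).trans (Finset.sum_le_sum fun i _ => ?_)
    rw [← sub_mul, abs_mul]
    exact mul_le_mul_of_nonneg_left ((hM i x hx).trans (le_abs_self _)) (abs_nonneg _)

/-! ### The space of model functions. -/

section Polynomials

variable {n : ℕ}

theorem realPolyEval_add (P Q : MvPolynomial (Fin n ⊕ Fin n) ℝ) (w : Fin n → ℂ) :
    realPolyEval (P + Q) w = realPolyEval P w + realPolyEval Q w := by
  simp [realPolyEval]

theorem continuous_realPolyEval (P : MvPolynomial (Fin n ⊕ Fin n) ℝ) :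
    Continuous (realPolyEval P) := by
  unfold realPolyEval
  refine (MvPolynomial.continuous_eval P).comp (continuous_pi ?_)
  rintro (i | i)
  · exact Complex.continuous_re.comp (continuous_apply i)
  · exact Complex.continuous_im.comp (continuous_apply i)

theorem exists_poly_along_line (P : MvPolynomial (Fin n ⊕ Fin n) ℝ) (w : Fin n → ℂ) :
    ∃ q : Polynomial ℝ, ∀ t : ℝ, realPolyEval P (fun i => (t : ℂ) * w i) = q.eval t := by
  induction P using MvPolynomial.induction_on with
  | C a => exact ⟨Polynomial.C a, fun t => by simp [realPolyEval]⟩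
  | add P Q hP hQ =>
    obtain ⟨q, hq⟩ := hP
    obtain ⟨q', hq'⟩ := hQ
    exact ⟨q + q', fun t => by rw [realPolyEval_add, hq, hq', Polynomial.eval_add]⟩
  | mul_X P i hP =>
    obtain ⟨q, hq⟩ := hP
    refine ⟨q * (Polynomial.C (Sum.elim (fun i => (w i).re) (fun i => (w i).im) i) *
      Polynomial.X), fun t => ?_⟩
    rw [Polynomial.eval_mul, ← hq]
    simp only [realPolyEval, map_mul, MvPolynomial.eval_X, Polynomial.eval_mul, Polynomial.eval_C,
      Polynomial.eval_X]
    rcases i with i | i <;> simp <;> left <;> ring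

/-- The homogeneous Taylor terms of a function in real-linear coordinates are polynomials. -/
theorem exists_poly_taylorTerm {E : Type*} [NormedAddCommGroup E] [NormedSpace ℝ E] (f : E → ℝ)
    (k : ℕ) (p : E) (e : Fin n ⊕ Fin n → E) :
    ∃ P : MvPolynomial (Fin n ⊕ Fin n) ℝ, P.totalDegree ≤ k ∧ ∀ w : Fin n → ℂ,
      realPolyEval P w = taylorTerm f k p
        (∑ i, Sum.elim (fun i => (w i).re) (fun i => (w i).im) i • e i) := by
  classical
  let M := iteratedFDeriv ℝ k f p
  refine ⟨∑ r : Fin k → Fin n ⊕ Fin n, MvPolynomial.C ((k.factorial : ℝ)⁻¹ * M fun i => e (r i)) *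
    ∏ i, MvPolynomial.X (r i), ?_, ?_⟩
  · refine MvPolynomial.totalDegree_finsetSum_le fun r _ => ?_
    refine (MvPolynomial.totalDegree_mul _ _).trans ?_
    rw [MvPolynomial.totalDegree_C, zero_add]
    refine (MvPolynomial.totalDegree_finsetProd _ _).trans ?_
    simp [MvPolynomial.totalDegree_X]
  · intro w
    set x : Fin n ⊕ Fin n → ℝ := Sum.elim (fun i => (w i).re) fun i => (w i).im with hx
    have h1 : M (fun _ => ∑ i, x i • e i) =
        ∑ r : Fin k → Fin n ⊕ Fin n, (∏ i, x (r i)) * M fun i => e (r i) := by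
      have h2 := M.toMultilinearMap.map_sum (fun _ : Fin k => fun j => x j • e j)
      refine h2.trans (Finset.sum_congr rfl fun r _ => ?_)
      exact M.toMultilinearMap.map_smul_univ (fun i => x (r i)) fun i => e (r i)
    rw [taylorTerm, h1, Finset.mul_sum]
    simp only [realPolyEval, map_sum, map_mul, map_prod, MvPolynomial.eval_C, MvPolynomial.eval_X]
    refine Finset.sum_congr rfl fun r _ => ?_
    ring

/-- Functions of the form `Re(b z_N) + P('z)` with `P` of degree at most `d`. -/
noncomputable def modelSpaceMap (n d : ℕ) :
    ((ℝ × ℝ) × MvPolynomial.restrictTotalDegree (Fin n ⊕ Fin n) ℝ d) →ₗ[ℝ]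
      (Cn (n + 1) → ℝ) where
  toFun v := fun z => v.1.1 * (z (Fin.last n)).re + v.1.2 * (z (Fin.last n)).im +
    realPolyEval v.2.1 fun i => z i.castSucc
  map_add' v v' := by
    funext z
    simp [realPolyEval_add]
    ring
  map_smul' c v := by
    funext z
    simp [realPolyEval, MvPolynomial.smul_eval]
    ring

/-- The fixed finite-dimensional space in which limits are extracted. The last variable enters only
linearly because τ_n is of order ε. -/
noncomputable def modelSpace (n d : ℕ) : Submodule ℝ (Cn (n + 1) → ℝ) :=
  LinearMap.range (modelSpaceMap n d)

theorem mem_modelSpace {d : ℕ} {f : Cn (n + 1) → ℝ} : f ∈ modelSpace n d ↔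
    ∃ (a b : ℝ) (P : MvPolynomial (Fin n ⊕ Fin n) ℝ), P.totalDegree ≤ d ∧ ∀ z : Cn (n + 1),
      f z = a * (z (Fin.last n)).re + b * (z (Fin.last n)).im +
        realPolyEval P fun i => z i.castSucc := by
  constructor
  · rintro ⟨⟨⟨a, b⟩, P, hP⟩, rfl⟩
    exact ⟨a, b, P, (MvPolynomial.mem_restrictTotalDegree _ _ _).mp hP, fun z => rfl⟩
  · rintro ⟨a, b, P, hP, h⟩
    exact ⟨⟨⟨a, b⟩, P, (MvPolynomial.mem_restrictTotalDegree _ _ _).mpr hP⟩,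
      funext fun z => (h z).symm⟩

instance finiteDimensional_modelSpace (n d : ℕ) : FiniteDimensional ℝ (modelSpace n d) := by
  unfold modelSpace; infer_instance

theorem continuous_of_mem_modelSpace {d : ℕ} {f : Cn (n + 1) → ℝ} (hf : f ∈ modelSpace n d) :
    Continuous f := by
  obtain ⟨a, b, P, -, h⟩ := mem_modelSpace.mp hf
  have : f = fun z => a * (z (Fin.last n)).re + b * (z (Fin.last n)).im +
      realPolyEval P fun i => z i.castSucc := funext h
  rw [this]
  have h1 : Continuous fun z : Cn (n + 1) => realPolyEval P fun i => z i.castSucc :=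
    (continuous_realPolyEval P).comp (by fun_prop)
  fun_prop

/-- Along each real line through 0 the function is a polynomial in one variable with infinitely many
zeros. -/
theorem eq_zero_of_mem_modelSpace {d : ℕ} {f : Cn (n + 1) → ℝ} (hf : f ∈ modelSpace n d)
    {B : Set (Cn (n + 1))} (hB : B ∈ 𝓝 0) (h0 : ∀ z ∈ B, f z = 0) : f = 0 := by
  obtain ⟨a, b, P, -, h⟩ := mem_modelSpace.mp hf
  funext z
  obtain ⟨q, hq⟩ := exists_poly_along_line P fun i => z i.castSucc
  have hpoly : ∀ t : ℝ, f (t • z) =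
      (Polynomial.C (a * (z (Fin.last n)).re + b * (z (Fin.last n)).im) * Polynomial.X + q).eval
        t := by
    intro t
    rw [h, Polynomial.eval_add, ← hq]
    simp
    ring
  have hcont : Continuous fun t : ℝ => t • z := by fun_prop
  have hev : ∀ᶠ t : ℝ in 𝓝 0, t • z ∈ B := hcont.continuousAt.eventually (by simpa using hB)
  have hinf : Set.Infinite {t : ℝ | t • z ∈ B} := infinite_of_mem_nhds 0 hev
  have hzero := Polynomial.eq_zero_of_infinite_isRoot
    (Polynomial.C (a * (z (Fin.last n)).re + b * (z (Fin.last n)).im) * Polynomial.X + q)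
    (hinf.mono fun t ht => by
      show Polynomial.IsRoot _ t
      rw [Polynomial.IsRoot, ← hpoly, h0 _ ht])
  have := hpoly 1
  rw [hzero, one_smul, Polynomial.eval_zero] at this
  exact this

end Polynomials

/-! ### Taylor approximation of the scaled functions. -/

section Scaling

variable {n : ℕ}

theorem scalingLin_apply {d : ℕ} (τ : Fin d → ℝ) (U : Cn d ≃ₗᵢ[ℂ] Cn d) (w : Cn d) :
    scalingLin τ U w = U.symm (WithLp.toLp 2 fun α => (τ α : ℂ) * w α) := by
  have := scalingMapInv_eq 0 τ U w
  rw [scalingMapInv, zero_add, zero_add] at this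
  exact this.symm

theorem norm_scalingLin_le {d : ℕ} {τ : Fin d → ℝ} {U : Cn d ≃ₗᵢ[ℂ] Cn d} {T : ℝ}
    (h0 : ∀ α, 0 ≤ τ α) (hT : ∀ α, τ α ≤ T) (hT0 : 0 ≤ T) (w : Cn d) :
    ‖scalingLin τ U w‖ ≤ T * ‖w‖ := by
  rw [scalingLin_apply, U.symm.norm_map]
  refine le_of_sq_le_sq ?_ (by positivity)
  rw [mul_pow, EuclideanSpace.norm_sq_eq, EuclideanSpace.norm_sq_eq, Finset.mul_sum]
  refine Finset.sum_le_sum fun α _ => ?_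
  simp only [norm_mul, Complex.norm_real, Real.norm_of_nonneg (h0 α), mul_pow]
  have := hT α
  have := h0 α
  gcongr

theorem scalingLin_single {τ : Fin (n + 1) → ℝ} {U : Cn (n + 1) ≃ₗᵢ[ℂ] Cn (n + 1)}
    (α : Fin (n + 1)) (c : ℂ) :
    scalingLin τ U (EuclideanSpace.single α c) = ((τ α : ℂ) * c) • extremalDir U α := by
  rw [scalingLin_apply, extremalDir, ← map_smul]
  congr 1
  ext i
  by_cases h : i = α
  · subst h; simp
  · simp [h]

/-- The point whose last coordinate is replaced by zero. -/
noncomputable def headPart (w : Cn (n + 1)) : Cn (n + 1) :=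
  w - EuclideanSpace.single (Fin.last n) (w (Fin.last n))

theorem headPart_add (w : Cn (n + 1)) :
    headPart w + EuclideanSpace.single (Fin.last n) (w (Fin.last n)) = w := by
  rw [headPart, sub_add_cancel]

theorem norm_headPart_le (w : Cn (n + 1)) : ‖headPart w‖ ≤ ‖w‖ := by
  refine le_of_sq_le_sq ?_ (norm_nonneg _)
  rw [EuclideanSpace.norm_sq_eq, EuclideanSpace.norm_sq_eq]
  refine Finset.sum_le_sum fun α _ => ?_
  by_cases h : α = Fin.last n
  · subst h; simp [headPart]
  · simp [headPart, h]

/-- The approximation of the scaled function by Taylor polynomials, linear in the last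
coordinate. -/
noncomputable def scaledTaylor (ρ : Cn (n + 1) → ℝ) (p0 p : Cn (n + 1))
    (A : Cn (n + 1) →L[ℂ] Cn (n + 1)) (ε : ℝ) (d : ℕ) (z : Cn (n + 1)) : ℝ :=
  (fderiv ℝ ρ p0 (A (EuclideanSpace.single (Fin.last n) (z (Fin.last n)))) +
    ∑ k ∈ Finset.range (d + 1), taylorTerm ρ k p (A (headPart z))) / ε

theorem scaledTaylor_mem (ρ : Cn (n + 1) → ℝ) (p0 p : Cn (n + 1))
    (A : Cn (n + 1) →L[ℂ] Cn (n + 1)) (ε : ℝ) (d : ℕ) :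
    scaledTaylor ρ p0 p A ε d ∈ modelSpace n d := by
  let e : Fin n ⊕ Fin n → Cn (n + 1) :=
    Sum.elim (fun i => EuclideanSpace.single i.castSucc 1)
      fun i => EuclideanSpace.single i.castSucc Complex.I
  have hhead : ∀ z : Cn (n + 1), headPart z =
      ∑ i, Sum.elim (fun i : Fin n => (z i.castSucc).re) (fun i => (z i.castSucc).im) i • e i := by
    intro z
    ext α
    rw [Fintype.sum_sum_type]
    simp only [Sum.elim_inl, Sum.elim_inr, e]
    induction α using Fin.lastCases with
    | last => simp [headPart, (Fin.castSucc_lt_last _).ne']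
    | cast i =>
      simp [headPart, (Fin.castSucc_lt_last i).ne, Pi.single_apply]
  have hA : ∀ z : Cn (n + 1), A (headPart z) =
      ∑ i, Sum.elim (fun i : Fin n => (z i.castSucc).re) (fun i => (z i.castSucc).im) i •
        A (e i) := by
    intro z
    rw [hhead, map_sum]
    refine Finset.sum_congr rfl fun i _ => ?_
    rw [← ofReal_smul_Cn, map_smul, ofReal_smul_Cn]
  choose P hPdeg hP using fun k => exists_poly_taylorTerm ρ k p fun i => A (e i)
  set l : ℂ := fderiv ℝ ρ p0 (A (EuclideanSpace.single (Fin.last n) 1)) -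
    Complex.I * fderiv ℝ ρ p0 (Complex.I • A (EuclideanSpace.single (Fin.last n) 1)) with hl
  rw [mem_modelSpace]
  refine ⟨l.re / ε, -l.im / ε, MvPolynomial.C ε⁻¹ * ∑ k ∈ Finset.range (d + 1), P k, ?_, ?_⟩
  · refine (MvPolynomial.totalDegree_mul _ _).trans ?_
    rw [MvPolynomial.totalDegree_C, zero_add]
    refine MvPolynomial.totalDegree_finsetSum_le fun k hk => (hPdeg k).trans ?_
    exact Nat.lt_succ_iff.mp (Finset.mem_range.mp hk)
  · intro z
    have h1 : A (EuclideanSpace.single (Fin.last n) (z (Fin.last n))) =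
        z (Fin.last n) • A (EuclideanSpace.single (Fin.last n) 1) := by
      rw [← map_smul]
      congr 1
      ext i
      by_cases h : i = Fin.last n
      · subst h; simp
      · simp [h]
    have h2 : ∑ k ∈ Finset.range (d + 1), taylorTerm ρ k p (A (headPart z)) =
        realPolyEval (∑ k ∈ Finset.range (d + 1), P k) fun i => z i.castSucc := by
      have h3 : realPolyEval (∑ k ∈ Finset.range (d + 1), P k) (fun i => z i.castSucc) =
          ∑ k ∈ Finset.range (d + 1), realPolyEval (P k) fun i => z i.castSucc := by
        simp [realPolyEval]
      rw [h3, hA]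
      exact Finset.sum_congr rfl fun k _ => (hP k _).symm
    rw [scaledTaylor, h1, real_linear_smul, ← hl, h2]
    simp only [realPolyEval, map_mul, MvPolynomial.eval_C, Complex.mul_re]
    ring

/-- The last coordinate displaces the point by O(ε), so linearising there with the derivative at
`p0` costs o(ε). The others displace it by O(T), and the Taylor remainder O(T^(d+1)) is again o(ε).
-/
theorem scaledTaylor_approx {ρ : Cn (n + 1) → ℝ} (hρ : ContDiff ℝ ∞ ρ) {p0 : Cn (n + 1)} (d : ℕ)
    {p : ℕ → Cn (n + 1)} (hp : Tendsto p atTop (𝓝 p0)) {A : ℕ → Cn (n + 1) →L[ℂ] Cn (n + 1)}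
    {ε T : ℕ → ℝ} (hε : ∀ j, 0 < ε j) (hT0 : ∀ j, 0 ≤ T j) (hT : Tendsto T atTop (𝓝 0))
    (hTε : Tendsto (fun j => T j ^ (d + 1) / ε j) atTop (𝓝 0))
    (hA : ∀ j w, ‖A j w‖ ≤ T j * ‖w‖) {C : ℝ} (hC : 0 < C)
    (hlast : ∀ᶠ j in atTop, ∀ c : ℂ,
      ‖A j (EuclideanSpace.single (Fin.last n) c)‖ ≤ C * ε j * ‖c‖)
    (R : ℝ) (hR : 0 < R) (δ : ℝ) (hδ : 0 < δ) :
    ∀ᶠ j in atTop, ∀ w ∈ Metric.closedBall (0 : Cn (n + 1)) R,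
      |ρ (p j + A j w) / ε j - scaledTaylor ρ p0 (p j) (A j) (ε j) d w| < δ := by
  obtain ⟨δ0, hδ0, happrox⟩ := exists_strict_approx hρ p0 (c := δ / (2 * (C * R))) (by positivity)
  obtain ⟨K, hK, hTay⟩ := exists_taylor_bound hρ p0 d
  have e1 : ∀ᶠ j in atTop, p j ∈ Metric.ball p0 (min (δ0 / 2) 1) :=
    hp.eventually (Metric.ball_mem_nhds p0 (by positivity))
  have e2 : ∀ᶠ j in atTop, T j < min (δ0 / 2) 1 / R :=
    hT.eventually (eventually_lt_nhds (by positivity))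
  have e3 : ∀ᶠ j in atTop, K * R ^ (d + 1) * (T j ^ (d + 1) / ε j) < δ / 2 := by
    have := hTε.const_mul (K * R ^ (d + 1))
    rw [mul_zero] at this
    exact this.eventually (eventually_lt_nhds (by positivity))
  filter_upwards [e1, e2, e3, hlast] with j h1 h2 h3 h4 w hw
  rw [mem_closedBall_zero_iff] at hw
  rw [lt_div_iff₀ hR] at h2
  rw [mem_ball_iff_norm] at h1
  have hsmall : ∀ v : Cn (n + 1), ‖v‖ ≤ R → ‖A j v‖ < min (δ0 / 2) 1 := fun v hv =>
    ((hA j v).trans (mul_le_mul_of_nonneg_left hv (hT0 j))).trans_lt h2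
  have hnear : ∀ v : Cn (n + 1), ‖v‖ ≤ R → p j + A j v ∈ Metric.ball p0 δ0 := by
    intro v hv
    rw [mem_ball_iff_norm]
    calc ‖p j + A j v - p0‖ = ‖(p j - p0) + A j v‖ := by congr 1; abel
      _ ≤ ‖p j - p0‖ + ‖A j v‖ := norm_add_le _ _
      _ < δ0 / 2 + δ0 / 2 := add_lt_add (h1.trans_le (min_le_left _ _))
          ((hsmall v hv).trans_le (min_le_left _ _))
      _ = δ0 := by ring
  have hhead := (norm_headPart_le w).trans hw
  set wN : Cn (n + 1) := EuclideanSpace.single (Fin.last n) (w (Fin.last n)) with hwN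
  have hsplit : A j w = A j (headPart w) + A j wN := by rw [← map_add, hwN, headPart_add]
  have h5 := happrox _ (hnear w hw) _ (hnear _ hhead)
  have e : p j + A j w - (p j + A j (headPart w)) = A j wN := by rw [hsplit]; abel
  rw [e] at h5
  have h6 : ‖A j wN‖ ≤ C * ε j * R := by
    refine (h4 _).trans ?_
    have : ‖w (Fin.last n)‖ ≤ R := (PiLp.norm_apply_le w (Fin.last n)).trans hw
    have := hε j
    gcongr
  have h7 := hTay (p j) (Metric.ball_subset_closedBall (mem_ball_iff_norm.mpr
    (h1.trans_le (min_le_right _ _)))) (A j (headPart w))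
    ((hsmall _ hhead).le.trans (min_le_right _ _))
  have h8 : ‖A j (headPart w)‖ ^ (d + 1) ≤ R ^ (d + 1) * T j ^ (d + 1) := by
    rw [← mul_pow]
    refine pow_le_pow_left₀ (norm_nonneg _) ?_ _
    refine (hA j _).trans ?_
    rw [mul_comm R]
    exact mul_le_mul_of_nonneg_left hhead (hT0 j)
  have hεj := hε j
  have h9 : δ / (2 * (C * R)) * ‖A j wN‖ ≤ δ / 2 * ε j := by
    calc _ ≤ δ / (2 * (C * R)) * (C * ε j * R) := by gcongr
      _ = δ / 2 * ε j := by field_simp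
  have h10 : K * ‖A j (headPart w)‖ ^ (d + 1) < δ / 2 * ε j := by
    calc _ ≤ K * (R ^ (d + 1) * T j ^ (d + 1)) := by gcongr
      _ = K * R ^ (d + 1) * (T j ^ (d + 1) / ε j) * ε j := by field_simp
      _ < δ / 2 * ε j := by gcongr
  rw [scaledTaylor, ← sub_div, abs_div, abs_of_pos hεj, div_lt_iff₀ hεj]
  calc _ = |(ρ (p j + A j w) - ρ (p j + A j (headPart w)) - fderiv ℝ ρ p0 (A j wN)) +
        (ρ (p j + A j (headPart w)) -
          ∑ k ∈ Finset.range (d + 1), taylorTerm ρ k (p j) (A j (headPart w)))| := by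
        congr 1; ring
    _ ≤ _ := abs_add_le _ _
    _ < δ / 2 * ε j + δ / 2 * ε j := by linarith
    _ = δ * ε j := by ring

end Scaling

/-! ### A fixed box inside the scaled domains. -/

section Box

variable {n : ℕ} {ρ : Cn (n + 1) → ℝ} {D : Set (Cn (n + 1))} {p : Cn (n + 1)}
  {τ : Fin (n + 1) → ℝ} {ζ : Fin (n + 1) → Cn (n + 1)} {U : Cn (n + 1) ≃ₗᵢ[ℂ] Cn (n + 1)}

/-- The point is the mean of n + 1 points, one in each extremal disc, each coordinate being
magnified by n + 1. -/
theorem box_subset (hD : D = {z | ρ z < 0}) (hopen : IsOpen D) (hconv : Convex ℝ D) (hp : p ∈ D)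
    (h : IsMcNealSystem ρ p (-ρ p) τ ζ U) {w : Cn (n + 1)}
    (hw : ∀ α, ‖w α‖ < 1 / (n + 1 : ℝ)) : p + scalingLin τ U w ∈ D := by
  have hN : (0 : ℝ) < n + 1 := by positivity
  have hNC : (n + 1 : ℂ) ≠ 0 := by exact_mod_cast hN.ne'
  have hmem : ∀ α, p + ((n + 1 : ℂ) * (τ α * w α)) • extremalDir U α ∈ D := by
    intro α
    have hτ := tau_pos hD hopen hp h α
    refine disc_extremalDir hD hopen hp h α ?_
    rw [norm_mul, norm_mul, Complex.norm_real, Real.norm_of_nonneg hτ.le]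
    have h1 : ‖(n + 1 : ℂ)‖ = n + 1 := by exact_mod_cast Complex.norm_natCast (n + 1)
    rw [h1]
    have h2 := hw α
    rw [lt_div_iff₀ hN] at h2
    nlinarith
  have hsum := hconv.sum_mem (t := Finset.univ) (w := fun _ : Fin (n + 1) => 1 / (n + 1 : ℝ))
    (fun _ _ => by positivity) (by simp; field_simp) (fun α _ => hmem α)
  convert hsum using 1
  have hwsum : w = ∑ α, EuclideanSpace.single α (w α) := by
    ext i
    simp [Pi.single_apply]
  have h3 : scalingLin τ U w = ∑ α, ((τ α : ℂ) * w α) • extremalDir U α := by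
    conv_lhs => rw [hwsum]
    rw [map_sum]
    exact Finset.sum_congr rfl fun α _ => scalingLin_single α _
  rw [h3]
  simp only [smul_add, Finset.sum_add_distrib, Finset.sum_const, Finset.card_univ,
    Fintype.card_fin]
  congr 1
  · rw [← Nat.cast_smul_eq_nsmul ℝ, smul_smul]
    push_cast
    rw [mul_one_div_cancel hN.ne', one_smul]
  · refine Finset.sum_congr rfl fun α _ => ?_
    rw [← ofReal_smul_Cn, smul_smul]
    congr 1
    push_cast
    field_simp

end Box

/-! ### Convexity of the limit polynomial. -/

section Convexity

variable {n : ℕ}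

/-- The point of `ℂ^(n+1)` with given first coordinates and last coordinate. -/
noncomputable def joinPoint (x : Fin n → ℂ) (c : ℂ) : Cn (n + 1) :=
  WithLp.toLp 2 (Fin.snoc (α := fun _ => ℂ) x c)

/-- For real last coordinate c the limit is negative exactly when c < -P, the region below a graph.
Points at height -P - δ eventually lie in the convex sublevel sets, hence so do their combinations;
passing to the limit gives convexity of P up to δ. -/
theorem convexOn_of_convex_sublevels {h : ℕ → Cn (n + 1) → ℝ} {P : (Fin n → ℂ) → ℝ} {b : ℝ}
    (hconv : ∀ j, Convex ℝ {z | h j z < 0})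
    (hlim : ∀ z : Cn (n + 1), Tendsto (fun j => h j z) atTop
      (𝓝 ((z (Fin.last n)).re + b * (z (Fin.last n)).im + P fun i => z i.castSucc))) :
    ConvexOn ℝ univ P := by
  refine ⟨convex_univ, fun x _ y _ s t hs ht hst => ?_⟩
  refine le_of_forall_pos_le_add fun δ hδ => ?_
  have hval : ∀ (x : Fin n → ℂ) (c : ℝ), Tendsto (fun j => h j (joinPoint x c)) atTop
      (𝓝 (c + P x)) := by
    intro x c
    have := hlim (joinPoint x c)
    simpa [joinPoint] using this
  have hneg : ∀ x : Fin n → ℂ, ∀ᶠ j in atTop, h j (joinPoint x ((-P x - δ : ℝ) : ℂ)) < 0 :=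
    fun x => (hval x (-P x - δ)).eventually (eventually_lt_nhds (by linarith))
  have hcomb : s • joinPoint x ((-P x - δ : ℝ) : ℂ) + t • joinPoint y ((-P y - δ : ℝ) : ℂ) =
      joinPoint (s • x + t • y) ((s * (-P x - δ) + t * (-P y - δ) : ℝ) : ℂ) := by
    ext i
    induction i using Fin.lastCases with
    | last => simp [joinPoint]
    | cast i => simp [joinPoint]
  have hle := le_of_tendsto (hval (s • x + t • y) (s * (-P x - δ) + t * (-P y - δ))) (b := 0) (by
    filter_upwards [hneg x, hneg y] with j hx hy
    have := hconv j hx hy hs ht hst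
    rw [hcomb] at this
    exact le_of_lt (show h j _ < 0 from this))
  have : s * (-P x - δ) + t * (-P y - δ) = -(s * P x + t * P y) - δ := by
    have : t = 1 - s := by linarith
    rw [this]; ring
  rw [this] at hle
  simp only [smul_eq_mul]
  linarith

end Convexity

/-! ### Asymptotics of the radii and extraction of the limit. -/

section Radii

variable {n : ℕ} {ρ : Cn (n + 1) → ℝ} {D : Set (Cn (n + 1))} {p0 : Cn (n + 1)}

theorem scaledFunction_eq (p : Cn (n + 1)) (τ : Fin (n + 1) → ℝ)
    (U : Cn (n + 1) ≃ₗᵢ[ℂ] Cn (n + 1)) (w : Cn (n + 1)) :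
    scaledFunction ρ p τ U w = ρ (p + scalingLin τ U w) / (-ρ p) := by
  rw [scaledFunction, scalingMapInv_eq]

theorem scaledFunction_neg_iff (hD : D = {z | ρ z < 0}) {p : Cn (n + 1)} (hp : ρ p < 0)
    (τ : Fin (n + 1) → ℝ) (U : Cn (n + 1) ≃ₗᵢ[ℂ] Cn (n + 1)) :
    {w | scaledFunction ρ p τ U w < 0} = scalingMapInv p τ U ⁻¹' D := by
  ext w
  simp only [mem_ofPred_eq, mem_preimage, hD, scaledFunction]
  rw [div_lt_iff₀ (by linarith), zero_mul]

theorem convex_scaledFunction_sublevel (hD : D = {z | ρ z < 0}) (hconv : Convex ℝ D)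
    {p : Cn (n + 1)} (hp : ρ p < 0)
    (τ : Fin (n + 1) → ℝ) (U : Cn (n + 1) ≃ₗᵢ[ℂ] Cn (n + 1)) :
    Convex ℝ {w | scaledFunction ρ p τ U w < 0} := by
  rw [scaledFunction_neg_iff hD hp]
  intro x hx y hy s t hs ht hst
  have h := hconv hx hy hs ht hst
  rw [scalingMapInv_eq, scalingMapInv_eq] at h
  rw [mem_preimage, scalingMapInv_eq]
  convert h using 1
  rw [map_add, ← ofReal_smul_Cn s x, ← ofReal_smul_Cn t y, map_smul, map_smul, ofReal_smul_Cn,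
    ofReal_smul_Cn, smul_add, smul_add]
  have : p = s • p + t • p := by rw [← add_smul, hst, one_smul]
  nth_rewrite 1 [this]
  abel

/-- The smallest radius is comparable to the value of the defining function. -/
theorem exists_last_radius_bound (hρ : ContDiff ℝ ∞ ρ) (hD : D = {z | ρ z < 0})
    (h0 : ρ p0 = 0) (hreg : fderiv ℝ ρ p0 ≠ 0) :
    ∃ C > 0, ∃ δ > 0, ∀ p ∈ Metric.ball p0 δ, ρ p < 0 → ∀ τ ζ U,
      IsMcNealSystem ρ p (-ρ p) τ ζ U → τ (Fin.last n) ≤ C * -ρ p := by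
  obtain ⟨η, hη, δ, hδ, hexit⟩ := exists_exit hρ hD h0 hreg
  have hη0 : 0 < ‖η‖ := by
    rw [norm_pos_iff]; rintro rfl; simp at hη
  refine ⟨2 * ‖η‖, by positivity, δ, hδ, fun p hp hneg τ ζ U h => ?_⟩
  have hopen := isOpen_of_sublevel hρ hD
  have hpD : p ∈ D := by rw [hD]; exact hneg
  have h1 := h.last_eq
  rw [shiftedDomain_neg hD] at h1
  by_contra! hlt
  refine (hexit p hp hneg).1 (ball_infDist_subset hopen hpD ?_)
  rw [← h1, norm_smul, Real.norm_of_nonneg (by linarith)]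
  linarith

/-- The largest of McNeal's radii. -/
noncomputable def maxRadius (τ : Fin (n + 1) → ℝ) : ℝ :=
  Finset.univ.sup' Finset.univ_nonempty τ

theorem le_maxRadius (τ : Fin (n + 1) → ℝ) (α : Fin (n + 1)) : τ α ≤ maxRadius τ :=
  Finset.le_sup' τ (Finset.mem_univ α)

theorem exists_eq_maxRadius (τ : Fin (n + 1) → ℝ) : ∃ α, maxRadius τ = τ α := by
  obtain ⟨α, -, h⟩ := Finset.exists_mem_eq_sup' Finset.univ_nonempty τ
  exact ⟨α, h⟩

/-- For T the largest radius, the disc bound gives min(T, s0)^k0 ≤ Cε. As ε → 0 this forces T → 0,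
so the minimum is eventually T and T^(k0+1)/ε ≤ C T. -/
theorem tendsto_maxRadius {k0 : ℕ} {p : ℕ → Cn (n + 1)} {τ : ℕ → Fin (n + 1) → ℝ}
    {ζ : ℕ → Fin (n + 1) → Cn (n + 1)} {U : ℕ → Cn (n + 1) ≃ₗᵢ[ℂ] Cn (n + 1)}
    (hρ : ContDiff ℝ ∞ ρ) (hD : D = {z | ρ z < 0})
    (hbdd : Bornology.IsBounded D) (hconv : Convex ℝ D) (h0 : ρ p0 = 0)
    (hreg : fderiv ℝ ρ p0 ≠ 0)
    (hne : ∀ v : Cn (n + 1), v ≠ 0 → ∃ θ : ℂ, ∃ k, 1 ≤ k ∧ k ≤ k0 ∧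
      taylorTerm ρ k p0 (θ • v) ≠ 0)
    (hp : ∀ j, p j ∈ D) (hlim : Tendsto p atTop (𝓝 p0))
    (hM : ∀ j, IsMcNealSystem ρ (p j) (-ρ (p j)) (τ j) (ζ j) (U j)) :
    Tendsto (fun j => maxRadius (τ j)) atTop (𝓝 0) ∧
      Tendsto (fun j => maxRadius (τ j) ^ (k0 + 1) / -ρ (p j)) atTop (𝓝 0) := by
  have hopen := isOpen_of_sublevel hρ hD
  have hneg : ∀ j, ρ (p j) < 0 := fun j => by have := hp j; rw [hD] at this; exact this
  have hTpos : ∀ j, 0 < maxRadius (τ j) := fun j =>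
    (tau_pos hD hopen (hp j) (hM j) 0).trans_le (le_maxRadius _ _)
  obtain ⟨C, hC, s0, hs0, δ, hδ, hrad⟩ :=
    exists_disc_radius_bound hρ hD hbdd hconv h0 hreg hne
  have hmain : ∀ᶠ j in atTop, min (maxRadius (τ j)) s0 ^ k0 ≤ C * -ρ (p j) := by
    filter_upwards [hlim.eventually (Metric.ball_mem_nhds p0 hδ)] with j hj
    obtain ⟨α, hα⟩ := exists_eq_maxRadius (τ j)
    refine hrad (p j) hj (hneg j) (extremalDir (U j) α) (norm_extremalDir α) _ (hTpos j) ?_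
    intro c hc
    rw [hα] at hc
    exact disc_extremalDir hD hopen (hp j) (hM j) α hc
  have hεlim : Tendsto (fun j => C * -ρ (p j)) atTop (𝓝 0) := by
    have h1 : Tendsto (fun j => ρ (p j)) atTop (𝓝 (ρ p0)) := (hρ.continuous.tendsto p0).comp hlim
    rw [h0] at h1
    simpa using (h1.neg).const_mul C
  have hsmall : ∀ e > 0, ∀ᶠ j in atTop, maxRadius (τ j) < min e s0 := by
    intro e he
    have hm : 0 < min e s0 := lt_min he hs0
    filter_upwards [hmain, hεlim.eventually (eventually_lt_nhds (pow_pos hm k0))] with j h1 h2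
    have h3 := lt_of_pow_lt_pow_left₀ k0 hm.le (h1.trans_lt h2)
    rcases min_lt_iff.mp h3 with h4 | h4
    · exact h4
    · exact absurd h4 (not_lt.mpr (min_le_right _ _))
  have hT : Tendsto (fun j => maxRadius (τ j)) atTop (𝓝 0) := by
    rw [tendsto_order]
    refine ⟨fun a ha => Eventually.of_forall fun j => ha.trans (hTpos j), fun a ha => ?_⟩
    exact (hsmall a ha).mono fun j hj => hj.trans_le (min_le_left _ _)
  refine ⟨hT, ?_⟩
  have hCT : Tendsto (fun j => C * maxRadius (τ j)) atTop (𝓝 0) := by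
    simpa using hT.const_mul C
  refine squeeze_zero' (Eventually.of_forall fun j => ?_) ?_ hCT
  · exact div_nonneg (pow_nonneg (hTpos j).le _) (by linarith [hneg j])
  · filter_upwards [hmain, hsmall 1 one_pos] with j h1 h2
    rw [min_eq_left (h2.le.trans (min_le_right _ _))] at h1
    rw [div_le_iff₀ (by linarith [hneg j]), pow_succ]
    have := hTpos j
    nlinarith

/-- After passing to a subsequence, the scaled defining functions converge to a model function. -/
theorem exists_subseq_scaledFunction {k0 : ℕ} {p : ℕ → Cn (n + 1)} {τ : ℕ → Fin (n + 1) → ℝ}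
    {ζ : ℕ → Fin (n + 1) → Cn (n + 1)} {U : ℕ → Cn (n + 1) ≃ₗᵢ[ℂ] Cn (n + 1)}
    (hρ : ContDiff ℝ ∞ ρ) (hD : D = {z | ρ z < 0})
    (hbdd : Bornology.IsBounded D) (hconv : Convex ℝ D) (h0 : ρ p0 = 0)
    (hreg : fderiv ℝ ρ p0 ≠ 0)
    (hne : ∀ v : Cn (n + 1), v ≠ 0 → ∃ θ : ℂ, ∃ k, 1 ≤ k ∧ k ≤ k0 ∧
      taylorTerm ρ k p0 (θ • v) ≠ 0)
    (hp : ∀ j, p j ∈ D) (hlim : Tendsto p atTop (𝓝 p0))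
    (hM : ∀ j, IsMcNealSystem ρ (p j) (-ρ (p j)) (τ j) (ζ j) (U j)) :
    ∃ φ : ℕ → ℕ, StrictMono φ ∧ ∃ g ∈ modelSpace n k0, ∀ K : Set (Cn (n + 1)), IsCompact K →
      TendstoUniformlyOn (fun j => scaledFunction ρ (p (φ j)) (τ (φ j)) (U (φ j))) g atTop K := by
  have hopen := isOpen_of_sublevel hρ hD
  have hneg : ∀ j, ρ (p j) < 0 := fun j => by have := hp j; rw [hD] at this; exact this
  obtain ⟨hT, hTε⟩ := tendsto_maxRadius hρ hD hbdd hconv h0 hreg hne hp hlim hM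
  have hτ : ∀ j α, 0 < τ j α := fun j α => tau_pos hD hopen (hp j) (hM j) α
  have hTnn : ∀ j, 0 ≤ maxRadius (τ j) := fun j => (hτ j 0).le.trans (le_maxRadius _ _)
  obtain ⟨C, hC, δ, hδ, hlastbd⟩ := exists_last_radius_bound (n := n) hρ hD h0 hreg
  obtain ⟨C', hC', δ', hδ', hrefl⟩ := exists_reflection_bound hρ hD hbdd hconv h0 hreg
  have hlast : ∀ᶠ j in atTop, ∀ c : ℂ,
      ‖scalingLin (τ j) (U j) (EuclideanSpace.single (Fin.last n) c)‖ ≤ C * -ρ (p j) * ‖c‖ := by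
    filter_upwards [hlim.eventually (Metric.ball_mem_nhds p0 hδ)] with j hj c
    rw [scalingLin_single, norm_smul, norm_extremalDir, mul_one, norm_mul, Complex.norm_real,
      Real.norm_of_nonneg (hτ j _).le]
    exact mul_le_mul_of_nonneg_right (hlastbd _ hj (hneg j) _ _ _ (hM j)) (norm_nonneg c)
  have happrox := scaledTaylor_approx hρ k0 hlim (A := fun j => scalingLin (τ j) (U j))
    (ε := fun j => -ρ (p j)) (fun j => by linarith [hneg j]) hTnn hT hTε
    (fun j w => norm_scalingLin_le (fun α => (hτ j α).le) (le_maxRadius _) (hTnn j) w) hC hlast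
  let f : ℕ → Cn (n + 1) → ℝ := fun j =>
    scaledTaylor ρ p0 (p j) (scalingLin (τ j) (U j)) (-ρ (p j)) k0
  -- For w in this box both w and -w are carried into D, so the reflection bound controls the scaled
  -- functions there; as a neighbourhood of 0, the box is a uniqueness set for the model space.
  let B : Set (Cn (n + 1)) := {w | ∀ α, ‖w α‖ < 1 / (n + 1 : ℝ)}
  have hB : B ∈ 𝓝 (0 : Cn (n + 1)) := by
    refine Metric.mem_nhds_iff.mpr ⟨1 / (n + 1 : ℝ), by positivity, fun w hw α => ?_⟩
    exact (PiLp.norm_apply_le w α).trans_lt (mem_ball_zero_iff.mp hw)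
  obtain ⟨φ, hφ, g, hg, hconvg⟩ := exists_subseq_tendsto_of_finiteDimensional (modelSpace n k0)
    (fun f hf => continuous_of_mem_modelSpace hf) B
    (fun f hf h => eq_zero_of_mem_modelSpace hf hB h) f (fun j => scaledTaylor_mem _ _ _ _ _ _) (by
      intro w hw
      refine ⟨C' + 1, ?_⟩
      filter_upwards [happrox (‖w‖ + 1) (by positivity) 1 one_pos,
        hlim.eventually (Metric.ball_mem_nhds p0 hδ')] with j h1 h2
      have h3 := h1 w (mem_closedBall_zero_iff.mpr (by linarith))
      have h4 := box_subset hD hopen hconv (hp j) (hM j) hw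
      have h5 : p j + scalingLin (τ j) (U j) (-w) ∈ D :=
        box_subset hD hopen hconv (hp j) (hM j) (fun α => by simpa using hw α)
      have h6 := hrefl (p j) h2 (hneg j) _ h4 (by
        convert h5 using 1
        rw [map_neg, two_smul]; abel)
      have h7 : ρ (p j + scalingLin (τ j) (U j) w) < 0 := by rw [hD] at h4; exact h4
      have hε : 0 < -ρ (p j) := by linarith [hneg j]
      have h8 : |ρ (p j + scalingLin (τ j) (U j) w) / -ρ (p j)| ≤ C' := by
        rw [abs_div, abs_of_neg h7, abs_of_pos hε, div_le_iff₀ hε]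
        exact h6
      have h9 : |f j w| ≤ |ρ (p j + scalingLin (τ j) (U j) w) / -ρ (p j)| +
          |ρ (p j + scalingLin (τ j) (U j) w) / -ρ (p j) - f j w| := by
        have := abs_sub_abs_le_abs_sub (f j w) (ρ (p j + scalingLin (τ j) (U j) w) / -ρ (p j))
        rw [abs_sub_comm (f j w)] at this
        linarith
      linarith)
  refine ⟨φ, hφ, g, hg, fun K hK => ?_⟩
  obtain ⟨R, hR⟩ := hK.isBounded.subset_closedBall 0
  rw [Metric.tendstoUniformlyOn_iff]
  intro e he
  have h1 := hφ.tendsto_atTop.eventually (happrox (|R| + 1) (by positivity) (e / 2) (by positivity))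
  have h2 := Metric.tendstoUniformlyOn_iff.mp (hconvg K hK) (e / 2) (by positivity)
  filter_upwards [h1, h2] with j h3 h4 w hw
  have h5 := h3 w (Metric.closedBall_subset_closedBall (by linarith [le_abs_self R]) (hR hw))
  have h6 := h4 w hw
  rw [Real.dist_eq] at h6 ⊢
  rw [scaledFunction_eq]
  have h7 := abs_sub_le (g w) (f (φ j) w)
    (ρ (p (φ j) + scalingLin (τ (φ j)) (U (φ j)) w) / -ρ (p (φ j)))
  rw [abs_sub_comm (f (φ j) w)] at h7
  have h8 : |ρ (p (φ j) + scalingLin (τ (φ j)) (U (φ j)) w) / -ρ (p (φ j)) - f (φ j) w| < e / 2 :=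
    h5
  linarith

end Radii

/-! ### The main theorem. -/

theorem theorem1p1 {n : ℕ} (ρ : Cn (n + 1) → ℝ) (D : Set (Cn (n + 1)))
    (hρ : IsSmoothDefiningFunction ρ D)
    (hbdd : Bornology.IsBounded D) (hconv : Convex ℝ D)
    (htype : ∀ q ∈ frontier D, dAngeloType ρ q < ⊤)
    (p0 : Cn (n + 1)) (hp0 : p0 ∈ frontier D)
    (p : ℕ → Cn (n + 1)) (hp : ∀ j, p j ∈ D) (hlim : Tendsto p atTop (𝓝 p0))
    (ε : ℕ → ℝ) (hε : ∀ j, ε j = -ρ (p j))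
    (τ : ℕ → Fin (n + 1) → ℝ) (ζ : ℕ → Fin (n + 1) → Cn (n + 1))
    (U : ℕ → Cn (n + 1) ≃ₗᵢ[ℂ] Cn (n + 1))
    (hMcN : ∀ j, IsMcNealSystem ρ (p j) (ε j) (τ j) (ζ j) (U j)) :
    ∃ φ : ℕ → ℕ, StrictMono φ ∧ ∃ M : Set (Cn (n + 1)),
      IsLocalModel ρ p0 (p ∘ φ) (τ ∘ φ) (U ∘ φ) M ∧
      Tendsto (fun j => kobayashiVol D (p (φ j)) * ∏ α, τ (φ j) α ^ 2) atTop
        (𝓝 (kobayashiVol M 0)) := by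
  have hsm := hρ.smooth
  have hD := hρ.sublevel
  have hreg := hρ.regular p0 hp0
  have hopen := isOpen_of_sublevel hsm hD
  have h0 := defining_eq_zero hsm hD hp0
  have hM : ∀ j, IsMcNealSystem ρ (p j) (-ρ (p j)) (τ j) (ζ j) (U j) := fun j => by
    rw [← hε]; exact hMcN j
  have hneg : ∀ j, ρ (p j) < 0 := fun j => by have := hp j; rw [hD] at this; exact this
  have hτ : ∀ j α, 0 < τ j α := fun j α => tau_pos hD hopen (hp j) (hM j) α
  obtain ⟨m, hm, hmtype, hne⟩ := exists_type_data hsm hD hconv hp0 hreg (htype p0 hp0)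
  obtain ⟨φ, hφ, g, hg, hunif⟩ :=
    exists_subseq_scaledFunction hsm hD hbdd hconv h0 hreg hne hp hlim hM
  obtain ⟨a, b, P, hP, hgP⟩ := mem_modelSpace.mp hg
  have hpt : ∀ z, Tendsto (fun j => scaledFunction ρ (p (φ j)) (τ (φ j)) (U (φ j)) z) atTop
      (𝓝 (g z)) := fun z => (hunif {z} isCompact_singleton).tendsto_at (mem_singleton z)
  have hg0 : g 0 = -1 := by
    refine tendsto_nhds_unique (hpt 0) (tendsto_const_nhds.congr fun j => ?_)
    rw [scaledFunction_eq, map_zero, add_zero, div_neg, div_self (hneg _).ne]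
  -- The inverse scaling carries e_n to ζ_n on ∂D, so all scaled functions vanish at e_n. With g(0)
  -- = -1 this fixes the coefficient of Re z_n as 1.
  have hgN : g (EuclideanSpace.single (Fin.last n) 1) = 0 := by
    refine tendsto_nhds_unique (hpt _) (tendsto_const_nhds.congr fun j => ?_)
    have h1 := zeta_sub (hM (φ j)) (Fin.last n)
    have h2 := (hM (φ j)).mem_frontier (Fin.last n)
    rw [shiftedDomain_neg hD] at h2
    rw [scaledFunction_eq, scalingLin_single, mul_one, ← h1, add_sub_cancel,
      defining_eq_zero hsm hD h2, zero_div]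
  have ha : a = 1 := by
    rw [hgP] at hg0 hgN
    simp [(Fin.castSucc_lt_last _).ne] at hg0 hgN
    linarith
  have hPconv : ConvexOn ℝ univ (realPolyEval P) := by
    refine convexOn_of_convex_sublevels (b := b)
      (h := fun j => scaledFunction ρ (p (φ j)) (τ (φ j)) (U (φ j)))
      (fun j => convex_scaledFunction_sublevel hD hconv (hneg _) _ _) fun z => ?_
    have := hpt z
    rwa [hgP, ha, one_mul] at this
  -- Re((1 - b i) z_n) = Re z_n + b Im z_n. The linear terms in 'z stay inside P, and adding 1 to P
  -- offsets the constant -1 of the model.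
  set β : Fin (n + 1) → ℂ := Pi.single (Fin.last n) (1 - b * Complex.I) with hβ
  set Q : MvPolynomial (Fin n ⊕ Fin n) ℝ := P + MvPolynomial.C 1 with hQ
  have hQeval : ∀ w, realPolyEval Q w = realPolyEval P w + 1 := by
    intro w
    rw [hQ, realPolyEval_add]
    simp [realPolyEval]
  have hmodel : modelFunction β Q = g := by
    funext z
    rw [modelFunction, hQeval, hgP, ha, hβ]
    simp [Pi.single_apply]
    ring
  have hQconv : ConvexOn ℝ univ (realPolyEval Q) := by
    have : realPolyEval Q = fun w => realPolyEval P w + 1 := funext hQeval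
    rw [this]
    exact hPconv.add_const 1
  have hgconv : ConvexOn ℝ univ g := by
    refine ⟨convex_univ, fun x _ y _ s t hs ht hst => ?_⟩
    have h1 := hPconv.2 (mem_univ fun i => x i.castSucc) (mem_univ fun i => y i.castSucc) hs ht hst
    rw [hgP, hgP x, hgP y]
    have h2 : (fun i => (s • x + t • y) i.castSucc) =
        s • (fun i : Fin n => x i.castSucc) + t • fun i : Fin n => y i.castSucc := by
      funext i; simp
    rw [h2]
    simp only [smul_eq_mul, PiLp.add_apply, PiLp.smul_apply, Complex.add_re, Complex.add_im,
      Complex.real_smul, Complex.re_ofReal_mul, Complex.im_ofReal_mul] at h1 ⊢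
    linarith
  refine ⟨φ, hφ, {z | modelFunction β Q z < 0}, ⟨m, β, Q, hm, hmtype, ?_, hQconv, ?_, rfl⟩, ?_⟩
  · refine (MvPolynomial.totalDegree_add _ _).trans (max_le hP ?_)
    rw [MvPolynomial.totalDegree_C]
    exact Nat.zero_le _
  · rw [hmodel]
    exact hunif
  · rw [hmodel]
    have key := tendsto_kobayashiVol hgconv (continuous_of_mem_modelSpace hg) hg0 hunif ?_
    · refine key.congr fun j => ?_
      rw [scaledFunction_neg_iff hD (hneg _), ← kobayashiVol_mul_prod _ _ _ _ (hτ (φ j))]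
    · intro r hr hr1
      -- The sum of the coordinate bounds, uniform in j and ψ as the stability lemma requires.
      refine ⟨∑ _α : Fin (n + 1), 2 ^ (n + 1) / (1 - r), fun j ψ hψ hmaps hψ0 z hz => ?_⟩
      rw [scaledFunction_neg_iff hD (hneg _)] at hmaps
      have hτ' : ∀ α, τ (φ j) α ≠ 0 := fun α => (hτ (φ j) α).ne'
      have hdiff : DifferentiableOn ℂ (fun z => scalingMapInv (p (φ j)) (τ (φ j)) (U (φ j)) (ψ z))
          (Metric.ball 0 1) := by
        simp only [scalingMapInv_eq]
        exact ((scalingLin (τ (φ j)) (U (φ j))).differentiable.comp_differentiableOn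
          hψ).const_add _
      have hbound : ∀ α, ‖ψ z α‖ ≤ 2 ^ (n + 1) / (1 - r) := by
        intro α
        have h1 := scaled_holomorphic_bound hD hopen hconv hbdd (hM (φ j)) hdiff
          (fun w hw => hmaps hw) (by rw [hψ0, scalingMapInv_eq, map_zero, add_zero])
          (hz.trans hr1) α
        rw [scalingMap_scalingMapInv _ _ _ hτ'] at h1
        refine h1.trans ?_
        have : 0 < 1 - r := by linarith
        gcongr
      have hsum : ψ z = ∑ α, EuclideanSpace.single α (ψ z α) := by
        ext i
        simp [Pi.single_apply]
      rw [hsum]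
      refine (norm_sum_le _ _).trans (Finset.sum_le_sum fun α _ => ?_)
      simpa using hbound α
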